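/- Let $N$ be a standard (rate-one) Poisson process on a filtered probability space $(\Omega,\mathcal F,(\mathcal F_t)_{t\ge 0},\mathbb P)$, adapted to $(\mathcal F_t)$ and with increments after time $t$ independent of $\mathcal F_t$, let $\widetilde N_t=N_t-t$ be the compensated process, and let $f$ be a real-valued predictable process such that almost surely $\int_0^t|f_s|\,ds<\infty$ and $\int_0^t\left|\frac{f_s}{1+f_s}\right|ds<\infty$ for all $t\ge 0$. Let $X_t=\int_0^t f_s\,d\widetilde N_s$ and $Y_t=\int_0^t\frac{-f_s}{1+f_s}\,d\widetilde N_s$. For $M_t=\int_0^t h_s\,d\widetilde N_s$, with $h$ predictable and almost surely locally integrable in time, let the Doléans-Dade exponential $\mathcal E(M_t)$ be the adapted, almost surely càdlàg process $Z$, unique up to indistinguishability, with $Z_t=1+\int_0^t Z_{s-}h_s\,d\widetilde N_s$. Assume that with probability $1$ the jumps of $X_t$ are strictly greater than $-1$. Then $\mathcal E(X_t)$ and $\mathcal E(Y_t)$ exist, almost surely $\int_0^t\frac{f_s^2}{1+f_s}\,ds$ converges absolutely for all $t\ge 0$, and almost surely, for all $t\ge 0$, $\mathcal E(X_t)\neq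 0$ and $$\mathcal{E}(X_t)^{-1}=\exp\left(\int_0^t\frac{f_s^2}{1+f_s}\,ds\right)\mathcal{E}\left(\int_0^t\frac{-f_s}{1+f_s}\,d\widetilde N_s\right).$$ -/

import Mathlib

open MeasureTheory ProbabilityTheory Filter Topology
open scoped NNReal ENNReal

noncomputable section

/-- Lebesgue measure on the time axis `[0, ∞)`. -/
def lebesgue : Measure ℝ≥0 := Measure.comap ((↑) : ℝ≥0 → ℝ) volume

/-- `ξ` is the standard Poisson process on the filtered probability space `(Ω, ℱ, P)`, regarded as a
random measure on the time axis `[0, ∞)`: it takes values in `{0, 1, 2, …, ∞}`, its intensity is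
Lebesgue measure, `ξ B` is Poisson distributed, the values on disjoint sets are independent, it is
adapted to `ℱ`, and its future after time `t` is independent of `ℱ t`. The counting process is
`N t = ξ (0, t]`. -/
structure IsStandardPoisson {Ω : Type*} [mΩ : MeasurableSpace Ω] (P : Measure Ω)
    (ℱ : Filtration ℝ≥0 mΩ) (ξ : Ω → Measure ℝ≥0) : Prop where
  integer_valued : ∀ ω (B : Set ℝ≥0), MeasurableSet B → ∃ n : ℕ∞, ξ ω B = (n : ℝ≥0∞)
  adapted : ∀ (t : ℝ≥0) (B : Set ℝ≥0), MeasurableSet B → B ⊆ Set.Iic t →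
    Measurable[ℱ t] (fun ω => ξ ω B)
  law : ∀ B : Set ℝ≥0, MeasurableSet B → lebesgue B < ∞ → ∀ k : ℕ,
    P {ω | ξ ω B = k} = poissonMeasure (lebesgue B).toNNReal {k}
  indep_disjoint : ∀ (n : ℕ) (A : Fin n → Set ℝ≥0), (∀ i, MeasurableSet (A i)) →
    Pairwise (fun i j => Disjoint (A i) (A j)) → iIndepFun (fun i ω => ξ ω (A i)) P
  indep_past : ∀ (t : ℝ≥0) (B : Set ℝ≥0), MeasurableSet B → B ⊆ Set.Ioi t →
    Indep (ℱ t) (MeasurableSpace.comap (fun ω => ξ ω B) inferInstance) P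

/-- The stochastic integral `∫_0^t f dÑ`, `Ñ = N - ds`, against the compensated Poisson process, as
a pathwise Lebesgue–Stieltjes integral over `(0, t]`. -/
def compInt {Ω : Type*} (ξ : Ω → Measure ℝ≥0) (f : ℝ≥0 → Ω → ℝ) (t : ℝ≥0) (ω : Ω) : ℝ :=
  (∫ s in Set.Ioc 0 t, f s ω ∂(ξ ω)) - ∫ s in Set.Ioc 0 t, f s ω ∂lebesgue

/-- Integrands for `Ñ`: predictable processes `f` with `∫_0^t |f| ds < ∞` for all `t`, almost
surely. -/
structure IsIntegrand {Ω : Type*} [mΩ : MeasurableSpace Ω] (P : Measure Ω)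
    (ℱ : Filtration ℝ≥0 mΩ) (f : ℝ≥0 → Ω → ℝ) : Prop where
  predictable : IsStronglyPredictable ℱ f
  integrable : ∀ᵐ ω ∂P, ∀ t : ℝ≥0, IntegrableOn (fun s => f s ω) (Set.Ioc 0 t) lebesgue

/-- A path on `[0, ∞)` that is right-continuous with left limits. -/
def IsCadlagPath (x : ℝ≥0 → ℝ) : Prop :=
  ∀ t, ContinuousWithinAt x (Set.Ici t) t ∧ ∃ l, Tendsto x (𝓝[<] t) (𝓝 l)

/-- The jump `x t - x (t-)` of a path at time `t` (it is `0` at `t = 0`). -/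
def jump (x : ℝ≥0 → ℝ) (t : ℝ≥0) : ℝ := x t - Function.leftLim x t

/-- `Z` is (a version of) the Doléans-Dade exponential of `X_t = ∫_0^t f dÑ`: an adapted, almost
surely càdlàg process that solves `dZ_t = Z_{t-} dX_t = f_t Z_{t-} dÑ_t`, `Z_0 = 1`. -/
structure IsDoleansDade {Ω : Type*} [mΩ : MeasurableSpace Ω] (P : Measure Ω)
    (ℱ : Filtration ℝ≥0 mΩ) (ξ : Ω → Measure ℝ≥0) (f : ℝ≥0 → Ω → ℝ) (Z : ℝ≥0 → Ω → ℝ) :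
    Prop where
  adapted : StronglyAdapted ℱ Z
  cadlag : ∀ᵐ ω ∂P, IsCadlagPath (fun s => Z s ω)
  sde : ∀ᵐ ω ∂P, ∀ t : ℝ≥0,
    Z t ω = 1 + compInt ξ (fun s ω' => f s ω' * Function.leftLim (fun r => Z r ω') s) t ω

end

noncomputable section

/-! ### Lebesgue measure on the half line -/

/-! Everything reduces to one path at a time. Almost surely `ξ ω` restricted to `(0, T]` is a finite
sum of distinct unit point masses (`ae_isSimpleCounting`, `exists_jumpTimes`), so the Doléans-Dade
equation becomes deterministic: between atoms the solution is multiplied by `exp (-∫ f ds)`, at an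
atom `s` by `1 + f s`. The jump of `X` at an atom is `f s` (`jump_pathInt`), so the hypothesis says
`1 + f > 0` at all atoms and the solution can be written `exp (∫ log (1 + f) dN - ∫ f ds)`, which is
`pathExp`. It solves the equation by induction on the number of jumps (`jumpExp_eq_add_integral`)
and is the only càdlàg solution by a Grönwall argument (`eq_of_eq_add_pathInt`).

With `g = -f / (1 + f)` one has `1 + g = (1 + f)⁻¹`, so the jump factors of the two exponentials
cancel, while the drifts combine through `f + g = f² / (1 + f)`; this is `pathExp_inv`.

The delicate point is that the drift identity needs `f ≠ -1` for Lebesgue-almost every time, whereas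
the jump hypothesis only sees the atoms. Predictability bridges the gap: by the compensation formula
(`compProd_apply_predictable`) a predictable set that meets no atom is null for `P ⊗ ds` on positive
times, and this applies to `{f = -1}`. -/

lemma measurableEmbedding_coe_nnreal : MeasurableEmbedding ((↑) : ℝ≥0 → ℝ) :=
  MeasurableEmbedding.subtype_coe measurableSet_Ici

lemma lebesgue_apply (s : Set ℝ≥0) : lebesgue s = volume (((↑) : ℝ≥0 → ℝ) '' s) :=
  measurableEmbedding_coe_nnreal.comap_apply _ _

lemma map_lebesgue : lebesgue.map ((↑) : ℝ≥0 → ℝ) = volume.restrict (Set.Ici 0) := by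
  rw [lebesgue, measurableEmbedding_coe_nnreal.map_comap, NNReal.range_coe]

lemma image_coe_Ioc (a b : ℝ≥0) : ((↑) : ℝ≥0 → ℝ) '' Set.Ioc a b = Set.Ioc (a : ℝ) b := by
  ext x
  constructor
  · rintro ⟨y, hy, rfl⟩
    exact ⟨by exact_mod_cast hy.1, by exact_mod_cast hy.2⟩
  · rintro ⟨h1, h2⟩
    exact ⟨⟨x, a.2.trans h1.le⟩, ⟨h1, h2⟩, rfl⟩

lemma lebesgue_Ioc (a b : ℝ≥0) : lebesgue (Set.Ioc a b) = (b - a : ℝ≥0) := by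
  rw [lebesgue_apply, image_coe_Ioc, Real.volume_Ioc, ← ENNReal.ofReal_coe_nnreal,
    NNReal.coe_sub_def, ENNReal.ofReal_max]
  simp

lemma lebesgue_Ioc_lt_top (a b : ℝ≥0) : lebesgue (Set.Ioc a b) < ∞ := by
  rw [lebesgue_Ioc]
  exact ENNReal.coe_lt_top

instance nullSingletonClass_lebesgue : NullSingletonClass lebesgue :=
  ⟨fun x => by rw [lebesgue_apply]; simp⟩

instance isLocallyFiniteMeasure_lebesgue : IsLocallyFiniteMeasure lebesgue := by
  refine ⟨fun x => ⟨Set.Iio (x + 1), Iio_mem_nhds (by simp), ?_⟩⟩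
  have h : Set.Iio (x + 1) ⊆ {0} ∪ Set.Ioc 0 (x + 1) := by
    intro y hy
    rcases eq_or_lt_of_le (zero_le (a := y)) with h | h
    · exact Or.inl h.symm
    · exact Or.inr ⟨h, le_of_lt hy⟩
  calc lebesgue (Set.Iio (x + 1)) ≤ lebesgue ({0} ∪ Set.Ioc 0 (x + 1)) := measure_mono h
    _ ≤ lebesgue {0} + lebesgue (Set.Ioc 0 (x + 1)) := measure_union_le _ _
    _ < ∞ := by
      rw [measure_singleton, zero_add]
      exact lebesgue_Ioc_lt_top _ _

lemma restrict_lebesgue_map (a b : ℝ≥0) :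
    (lebesgue.restrict (Set.Ioc a b)).map ((↑) : ℝ≥0 → ℝ)
      = volume.restrict (Set.Ioc (a : ℝ) b) := by
  have h : Set.Ioc a b = ((↑) : ℝ≥0 → ℝ) ⁻¹' Set.Ioc (a : ℝ) b := by
    ext x; simp
  rw [h, ← measurableEmbedding_coe_nnreal.restrict_map, map_lebesgue,
    Measure.restrict_restrict measurableSet_Ioc]
  congr 1
  ext x
  simp only [Set.mem_inter_iff, Set.mem_Ioc, Set.mem_Ici, and_iff_left_iff_imp]
  exact fun hx => a.2.trans hx.1.le

lemma setIntegral_lebesgue_Ioc (f : ℝ≥0 → ℝ) {a b : ℝ≥0} (hab : a ≤ b) :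
    ∫ s in Set.Ioc a b, f s ∂lebesgue = ∫ x in (a : ℝ)..b, f x.toNNReal := by
  rw [intervalIntegral.integral_of_le (by exact_mod_cast hab), ← restrict_lebesgue_map,
    measurableEmbedding_coe_nnreal.integral_map]
  simp

lemma integrableOn_lebesgue_Ioc_iff (f : ℝ≥0 → ℝ) {a b : ℝ≥0} (hab : a ≤ b) :
    IntegrableOn f (Set.Ioc a b) lebesgue ↔
      IntervalIntegrable (fun x : ℝ => f x.toNNReal) volume a b := by
  rw [intervalIntegrable_iff_integrableOn_Ioc_of_le (by exact_mod_cast hab), IntegrableOn,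
    IntegrableOn, ← restrict_lebesgue_map, measurableEmbedding_coe_nnreal.integrable_map_iff]
  simp [Function.comp_def]

/-! ### The exponential of an indefinite integral -/

/-- The Lipschitz condition is asked only on the range of `f`, because the exponential is not
globally Lipschitz. -/
lemma AbsolutelyContinuousOnInterval.lipschitz_comp {f h : ℝ → ℝ} {a b : ℝ} {K : ℝ≥0}
    (hf : AbsolutelyContinuousOnInterval f a b)
    (hh : LipschitzOnWith K h (f '' Set.uIcc a b)) :
    AbsolutelyContinuousOnInterval (fun x => h (f x)) a b := by
  rw [absolutelyContinuousOnInterval_iff] at hf ⊢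
  intro ε hε
  -- Dividing by `K + 1` also covers `K = 0`.
  obtain ⟨δ, hδ, H⟩ := hf (ε / (K + 1)) (by positivity)
  refine ⟨δ, hδ, fun E hE hlt => ?_⟩
  calc
    _ ≤ ∑ i ∈ Finset.range E.1, K * dist (f (E.2 i).1) (f (E.2 i).2) := by
      refine Finset.sum_le_sum fun i hi => hh.dist_le_mul _ ?_ _ ?_
      · exact ⟨_, (hE.left i hi).left, rfl⟩
      · exact ⟨_, (hE.left i hi).right, rfl⟩
    _ = K * ∑ i ∈ Finset.range E.1, dist (f (E.2 i).1) (f (E.2 i).2) := by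
      rw [Finset.mul_sum]
    _ ≤ K * (ε / (K + 1)) := by
      have := (H E hE hlt).le
      gcongr
    _ < (K + 1) * (ε / (K + 1)) := by gcongr; linarith
    _ = ε := by field

/-- Since `f` is merely integrable, the chain rule holds only almost everywhere; absolute continuity
of the composite is what lets its derivative integrate back. -/
lemma exp_neg_intervalIntegral {f : ℝ → ℝ} {T : ℝ}
    (hf : IntervalIntegrable f volume 0 T) :
    Real.exp (-∫ x in (0 : ℝ)..T, f x)
      = 1 - ∫ x in (0 : ℝ)..T, f x * Real.exp (-∫ y in (0 : ℝ)..x, f y) := by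
  have hG := hf.absolutelyContinuousOnInterval_intervalIntegral (c := 0) (by simp)
  obtain ⟨K, hK⟩ : ∃ K, LipschitzOnWith K (fun x : ℝ => Real.exp (-x))
      ((fun x => ∫ y in (0 : ℝ)..x, f y) '' Set.uIcc 0 T) := by
    obtain ⟨C, hC⟩ := hG.exists_bound
    have h1 : ContDiffOn ℝ 1 (fun x : ℝ => Real.exp (-x)) (Set.Icc (-C) C) := by fun_prop
    obtain ⟨K, hK⟩ := h1.exists_lipschitzOnWith (by decide) (convex_Icc _ _) isCompact_Icc
    refine ⟨K, hK.mono ?_⟩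
    rintro _ ⟨x, hx, rfl⟩
    exact abs_le.1 (hC x hx)
  have hE := hG.lipschitz_comp hK
  have h := hE.integral_deriv_eq_sub
  simp only [intervalIntegral.integral_same, neg_zero, Real.exp_zero] at h
  have h2 : ∫ x in (0 : ℝ)..T, deriv (fun x => Real.exp (-∫ y in (0 : ℝ)..x, f y)) x
      = ∫ x in (0 : ℝ)..T, -(f x * Real.exp (-∫ y in (0 : ℝ)..x, f y)) := by
    apply intervalIntegral.integral_congr_ae
    filter_upwards [hf.ae_hasDerivAt_integral] with x hx hxm
    have := (hx (Set.uIoc_subset_uIcc hxm) 0 (by simp)).fun_neg.exp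
    rw [this.deriv]
    ring
  rw [h2, intervalIntegral.integral_neg] at h
  linarith

/-- The integral of a path up to time `t`. -/
def timeInt (f : ℝ≥0 → ℝ) (t : ℝ≥0) : ℝ := ∫ s in Set.Ioc 0 t, f s ∂lebesgue

lemma continuous_timeInt {f : ℝ≥0 → ℝ} (hf : ∀ t, IntegrableOn f (Set.Ioc 0 t) lebesgue) :
    Continuous (timeInt f) := by
  have h1 : timeInt f = (fun x : ℝ => ∫ y in (0 : ℝ)..x, f y.toNNReal) ∘ ((↑) : ℝ≥0 → ℝ) := by
    funext t
    simp [timeInt, setIntegral_lebesgue_Ioc f zero_le]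
  rw [continuous_iff_continuousAt]
  intro t
  have h2 := (integrableOn_lebesgue_Ioc_iff f zero_le).1 (hf (t + 1))
  have h3 := intervalIntegral.continuousOn_primitive_interval'
    (μ := volume) h2 (a := 0) (by simp)
  rw [h1]
  have h4 : ContinuousOn ((fun x : ℝ => ∫ y in (0 : ℝ)..x, f y.toNNReal) ∘ ((↑) : ℝ≥0 → ℝ))
      (Set.Iic (t + 1)) := by
    refine h3.comp NNReal.continuous_coe.continuousOn fun x hx => ?_
    rw [NNReal.coe_zero, Set.uIcc_of_le (NNReal.coe_nonneg _)]
    exact ⟨x.coe_nonneg, by exact_mod_cast hx⟩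
  exact h4.continuousAt (Iic_mem_nhds (by simp))

lemma exp_neg_timeInt {f : ℝ≥0 → ℝ} (hf : ∀ t, IntegrableOn f (Set.Ioc 0 t) lebesgue) (t : ℝ≥0) :
    Real.exp (-timeInt f t) = 1 - ∫ s in Set.Ioc 0 t, f s * Real.exp (-timeInt f s) ∂lebesgue := by
  have h := exp_neg_intervalIntegral ((integrableOn_lebesgue_Ioc_iff f zero_le).1 (hf t))
  rw [setIntegral_lebesgue_Ioc _ zero_le, timeInt, setIntegral_lebesgue_Ioc _ zero_le]
  convert! h using 2
  apply intervalIntegral.integral_congr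
  intro x hx
  simp only [NNReal.coe_zero] at hx
  have hx0 : 0 ≤ x := by
    rw [Set.uIcc_of_le t.coe_nonneg] at hx; exact hx.1
  simp only [timeInt]
  rw [setIntegral_lebesgue_Ioc _ zero_le]
  simp [Real.coe_toNNReal x hx0]

/-! ### Càdlàg paths -/

namespace IsCadlagPath

variable {x y : ℝ≥0 → ℝ}

lemma sub (hx : IsCadlagPath x) (hy : IsCadlagPath y) : IsCadlagPath (fun t => x t - y t) := by
  intro t
  obtain ⟨hx1, l, hl⟩ := hx t
  obtain ⟨hy1, l', hl'⟩ := hy t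
  exact ⟨hx1.sub hy1, l - l', hl.sub hl'⟩

lemma tendsto_leftLim (hx : IsCadlagPath x) (t : ℝ≥0) :
    Tendsto x (𝓝[<] t) (𝓝 (Function.leftLim x t)) :=
  tendsto_leftLim_of_tendsto (hx t).2

lemma leftLim_sub (hx : IsCadlagPath x) (hy : IsCadlagPath y) {t : ℝ≥0} (ht : 0 < t) :
    Function.leftLim (fun t => x t - y t) t = Function.leftLim x t - Function.leftLim y t :=
  have := nhdsLT_neBot_of_exists_lt ⟨0, ht⟩
  leftLim_eq_of_tendsto ((hx.tendsto_leftLim t).sub (hy.tendsto_leftLim t))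

lemma exists_bound (hx : IsCadlagPath x) (T : ℝ≥0) : ∃ C, ∀ t ≤ T, |x t| ≤ C := by
  have hc : IsCompact (Set.Icc 0 T) := isCompact_Icc
  suffices h : ∃ C, ∀ t ∈ Set.Icc 0 T, |x t| ≤ C by
    obtain ⟨C, hC⟩ := h
    exact ⟨C, fun t ht => hC t ⟨zero_le, ht⟩⟩
  refine hc.induction_on (p := fun s => ∃ C, ∀ t ∈ s, |x t| ≤ C) ⟨0, by simp⟩ ?_ ?_ ?_
  · rintro s t hst ⟨C, hC⟩
    exact ⟨C, fun u hu => hC u (hst hu)⟩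
  · rintro s t ⟨C, hC⟩ ⟨C', hC'⟩
    refine ⟨max C C', fun u hu => ?_⟩
    rcases hu with hu | hu
    · exact (hC u hu).trans (le_max_left _ _)
    · exact (hC' u hu).trans (le_max_right _ _)
  · intro t _
    obtain ⟨h1, l, h2⟩ := hx t
    have h1' : ∀ᶠ s in 𝓝[≥] t, |x s| ≤ |x t| + 1 :=
      (h1.abs.eventually_lt_const (lt_add_one _)).mono fun _ h => le_of_lt h
    have h2' : ∀ᶠ s in 𝓝[<] t, |x s| ≤ |l| + 1 :=
      (h2.abs.eventually_lt_const (lt_add_one _)).mono fun _ h => le_of_lt h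
    have h3 : ∀ᶠ s in 𝓝 t, |x s| ≤ max (|x t| + 1) (|l| + 1) := by
      rw [← nhdsLT_sup_nhdsGE, eventually_sup]
      exact ⟨h2'.mono fun s hs => hs.trans (le_max_right _ _),
        h1'.mono fun s hs => hs.trans (le_max_left _ _)⟩
    exact ⟨_, mem_nhdsWithin_of_mem_nhds h3, _, fun s hs => hs⟩

lemma abs_leftLim_le (hx : IsCadlagPath x) {a t : ℝ≥0} {C : ℝ} (hat : a < t)
    (hC : ∀ s, a < s → s < t → |x s| ≤ C) : |Function.leftLim x t| ≤ C := by
  have := nhdsLT_neBot_of_exists_lt ⟨a, hat⟩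
  refine le_of_tendsto (hx.tendsto_leftLim t).abs ?_
  filter_upwards [Ioo_mem_nhdsLT hat] with s hs using hC s hs.1 hs.2

/-- The points `(⌈n s⌉ - 1) / n` lie strictly below `s > 0` and converge to it, and each approximant
factors through `ℕ`. At `s = 0` truncated subtraction gives the point `0`, matching the convention
that the left limit there is the value. -/
lemma measurable_leftLim (hx : IsCadlagPath x) : Measurable (Function.leftLim x) := by
  have hm : ∀ n : ℕ, Measurable fun s : ℝ≥0 =>
      x (((⌈(n : ℝ≥0) * s⌉₊ - 1 : ℕ) : ℝ≥0) / n) := by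
    intro n
    have h1 : Measurable fun s : ℝ≥0 => ⌈(n : ℝ≥0) * s⌉₊ :=
      Nat.measurable_ceil.comp (measurable_const_mul _)
    exact (measurable_from_nat (f := fun k : ℕ => x (((k - 1 : ℕ) : ℝ≥0) / n))).comp h1
  refine measurable_of_tendsto_metrizable hm (tendsto_pi_nhds.2 fun s => ?_)
  rcases eq_or_lt_of_le (zero_le (a := s)) with rfl | hs
  · have : Function.leftLim x 0 = x 0 := leftLim_eq_of_isBot isBot_bot
    simp [this]
  · refine (hx.tendsto_leftLim s).comp ?_
    refine tendsto_nhdsWithin_iff.2 ⟨?_, ?_⟩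
    · have h0 : Tendsto (fun n : ℕ => (s : ℝ) - 1 / (n : ℝ)) atTop (𝓝 (s - 0)) :=
        tendsto_const_nhds.sub tendsto_one_div_atTop_nhds_zero_nat
      rw [sub_zero] at h0
      rw [← NNReal.tendsto_coe]
      refine tendsto_of_tendsto_of_tendsto_of_le_of_le' h0 tendsto_const_nhds ?_ ?_
      · filter_upwards [eventually_gt_atTop 0] with n hn
        have hn' : (0 : ℝ) < n := by exact_mod_cast hn
        have hpos : 0 < ⌈(n : ℝ≥0) * s⌉₊ := Nat.ceil_pos.2 (mul_pos (by exact_mod_cast hn) hs)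
        have h2 : ((n : ℝ≥0) * s : ℝ≥0) ≤ ⌈(n : ℝ≥0) * s⌉₊ := Nat.le_ceil _
        have h3 : (n : ℝ) * s ≤ (⌈(n : ℝ≥0) * s⌉₊ : ℝ) := by exact_mod_cast h2
        rw [NNReal.coe_div, NNReal.coe_natCast, NNReal.coe_natCast, Nat.cast_sub hpos, Nat.cast_one]
        rw [le_div_iff₀ hn', sub_mul, one_div, inv_mul_cancel₀ hn'.ne']
        linarith
      · filter_upwards [eventually_gt_atTop 0] with n hn
        have hn' : (0 : ℝ) < n := by exact_mod_cast hn
        have hpos : 0 < ⌈(n : ℝ≥0) * s⌉₊ := Nat.ceil_pos.2 (mul_pos (by exact_mod_cast hn) hs)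
        have h2 : ((⌈(n : ℝ≥0) * s⌉₊ : ℝ≥0)) < n * s + 1 := Nat.ceil_lt_add_one zero_le
        have h3 : (⌈(n : ℝ≥0) * s⌉₊ : ℝ) < n * s + 1 := by exact_mod_cast h2
        rw [NNReal.coe_div, NNReal.coe_natCast, NNReal.coe_natCast, Nat.cast_sub hpos, Nat.cast_one]
        rw [div_le_iff₀ hn']
        linarith
    · filter_upwards [eventually_gt_atTop 0] with n hn
      have hn' : (0 : ℝ) < n := by exact_mod_cast hn
      have hpos : 0 < ⌈(n : ℝ≥0) * s⌉₊ := Nat.ceil_pos.2 (mul_pos (by exact_mod_cast hn) hs)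
      have h2 : ((⌈(n : ℝ≥0) * s⌉₊ : ℝ≥0)) < n * s + 1 := Nat.ceil_lt_add_one zero_le
      have h3 : (⌈(n : ℝ≥0) * s⌉₊ : ℝ) < n * s + 1 := by exact_mod_cast h2
      rw [Set.mem_Iio, ← NNReal.coe_lt_coe]
      rw [NNReal.coe_div, NNReal.coe_natCast, NNReal.coe_natCast, Nat.cast_sub hpos, Nat.cast_one]
      rw [div_lt_iff₀ hn']
      linarith

lemma integrableOn_mul_leftLim (hx : IsCadlagPath x) {f : ℝ≥0 → ℝ} {μ : Measure ℝ≥0} {T : ℝ≥0}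
    (hf : IntegrableOn f (Set.Ioc 0 T) μ) :
    IntegrableOn (fun s => f s * Function.leftLim x s) (Set.Ioc 0 T) μ := by
  obtain ⟨C, hC⟩ := hx.exists_bound T
  refine Integrable.mul_bdd (c := C) hf hx.measurable_leftLim.aestronglyMeasurable ?_
  filter_upwards [ae_restrict_mem measurableSet_Ioc] with s hs
  exact hx.abs_leftLim_le hs.1 fun r _ hr => hC r (hr.le.trans hs.2)

/-- A Grönwall-type uniqueness principle for integral inequalities against a measure with atoms. -/
lemma eq_zero_of_enorm_le (hx : IsCadlagPath x) {ν : Measure ℝ≥0} {T : ℝ≥0}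
    (hν : ν (Set.Ioc 0 T) < ∞)
    (h : ∀ t ≤ T, ‖x t‖ₑ ≤ ∫⁻ s in Set.Ioc 0 t, ‖Function.leftLim x s‖ₑ ∂ν) :
    ∀ t ≤ T, x t = 0 := by
  by_contra! hne
  obtain ⟨t₁, ht₁, hxt₁⟩ := hne
  set A : Set ℝ≥0 := {t | t ≤ T ∧ x t ≠ 0} with hA
  have hAne : A.Nonempty := ⟨t₁, ht₁, hxt₁⟩
  set a := sInf A with ha
  have haT : a ≤ T := (csInf_le (OrderBot.bddBelow A) ⟨ht₁, hxt₁⟩).trans ht₁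
  have hlt : ∀ s < a, x s = 0 := by
    intro s hs
    by_contra hs0
    exact absurd (csInf_le (OrderBot.bddBelow A) ⟨hs.le.trans haT, hs0⟩) (not_le.2 hs)
  have hleft : ∀ s, 0 < s → s ≤ a → Function.leftLim x s = 0 := by
    intro s hs hsa
    have := hx.abs_leftLim_le (C := 0) hs
      fun r _ hr => by rw [hlt r (hr.trans_le hsa), abs_zero]
    simpa using this
  -- An atom of `ν` at `a` does no harm: the integrand is the left limit, which vanishes up to and
  -- including `a`.
  have hxa : x a = 0 := by
    have h1 := h a haT
    rw [setLIntegral_congr_fun (g := fun _ => 0) measurableSet_Ioc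
      (fun s hs => by simp [hleft s hs.1 hs.2])] at h1
    simpa using h1
  have haT' : a < T := by
    refine lt_of_le_of_ne haT fun haT' => ?_
    have : t₁ = a := le_antisymm (ht₁.trans haT'.ge) (csInf_le (OrderBot.bddBelow A) ⟨ht₁, hxt₁⟩)
    exact hxt₁ (this ▸ hxa)
  -- the measure of `(a, b]` is small for `b` close to `a`
  obtain ⟨b, hab, hbT, hb⟩ : ∃ b, a < b ∧ b ≤ T ∧ ν (Set.Ioc a b) ≤ 2⁻¹ := by
    obtain ⟨u, hu_anti, hu_mem, hu_lim⟩ := exists_seq_strictAnti_tendsto' haT'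
    have hI : ⋂ n, Set.Ioc a (u n) = ∅ := by
      ext s
      simp only [Set.mem_iInter, Set.mem_Ioc, Set.mem_empty_iff_false, iff_false, not_forall]
      by_cases has : a < s
      · obtain ⟨n, hn⟩ := (hu_lim.eventually_lt_const has).exists
        exact ⟨n, fun hs => absurd hs.2 (not_le.2 hn)⟩
      · exact ⟨0, fun hs => has hs.1⟩
    have hlim := tendsto_measure_iInter_atTop (μ := ν) (s := fun n => Set.Ioc a (u n))
      (fun n => measurableSet_Ioc.nullMeasurableSet)
      (fun m n hmn => Set.Ioc_subset_Ioc_right (hu_anti.antitone hmn))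
      ⟨0, ((measure_mono (Set.Ioc_subset_Ioc zero_le (hu_mem 0).2.le)).trans_lt hν).ne⟩
    rw [hI, measure_empty] at hlim
    obtain ⟨n, hn⟩ := (hlim.eventually_lt_const (u := 2⁻¹) (by simp)).exists
    exact ⟨u n, (hu_mem n).1, (hu_mem n).2.le, hn.le⟩
  -- the supremum of `‖x‖` on `(a, b]`
  set M : ℝ≥0∞ := ⨆ s ∈ Set.Ioc a b, ‖x s‖ₑ with hM
  have hMle : ∀ s ∈ Set.Ioc a b, ‖x s‖ₑ ≤ M := fun s hs => le_iSup₂ (f := fun s _ => ‖x s‖ₑ) s hs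
  have hMtop : M ≠ ∞ := by
    obtain ⟨C, hC⟩ := hx.exists_bound b
    refine ne_of_lt (lt_of_le_of_lt (iSup₂_le (a := ENNReal.ofReal C) fun s hs => ?_)
      ENNReal.ofReal_lt_top)
    rw [← ofReal_norm]
    exact ENNReal.ofReal_le_ofReal (hC s hs.2)
  have hleftM : ∀ s ∈ Set.Ioc a b, ‖Function.leftLim x s‖ₑ ≤ M := by
    intro s hs
    have := hx.abs_leftLim_le (C := M.toReal) hs.1 fun r hr hrs => by
      have h1 := hMle r ⟨hr, hrs.le.trans hs.2⟩
      have h2 := ENNReal.toReal_mono hMtop h1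
      simpa using h2
    rw [← ofReal_norm]
    exact ENNReal.ofReal_le_of_le_toReal this
  -- Only `(a, b]` contributes to the integral, and its mass is at most one half; as `M` is finite,
  -- this forces `M = 0`.
  have hMhalf : M ≤ M * 2⁻¹ := by
    refine iSup₂_le fun t ht => ?_
    calc ‖x t‖ₑ ≤ ∫⁻ s in Set.Ioc 0 t, ‖Function.leftLim x s‖ₑ ∂ν := h t (ht.2.trans hbT)
      _ ≤ ∫⁻ s in Set.Ioc 0 b, ‖Function.leftLim x s‖ₑ ∂ν :=
        lintegral_mono_set (Set.Ioc_subset_Ioc_right ht.2)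
      _ = ∫⁻ s in Set.Ioc 0 a ∪ Set.Ioc a b, ‖Function.leftLim x s‖ₑ ∂ν := by
        rw [Set.Ioc_union_Ioc_eq_Ioc zero_le hab.le]
      _ ≤ ∫⁻ s in Set.Ioc 0 a, ‖Function.leftLim x s‖ₑ ∂ν
          + ∫⁻ s in Set.Ioc a b, ‖Function.leftLim x s‖ₑ ∂ν := lintegral_union_le _ _ _
      _ ≤ 0 + ∫⁻ _ in Set.Ioc a b, M ∂ν := by
        gcongr ?_ + ?_
        · rw [setLIntegral_congr_fun (g := fun _ => 0) measurableSet_Ioc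
            (fun s hs => by simp [hleft s hs.1 hs.2])]
          simp
        · exact setLIntegral_mono' measurableSet_Ioc hleftM
      _ = M * ν (Set.Ioc a b) := by rw [zero_add, setLIntegral_const]
      _ ≤ M * 2⁻¹ := by gcongr
  have hM0 : M = 0 := by
    by_contra hM0
    have : M * 2⁻¹ < M := by
      rw [← div_eq_mul_inv]
      exact ENNReal.half_lt_self hM0 hMtop
    exact absurd hMhalf (not_le.2 this)
  have : b ≤ a := by
    refine le_csInf hAne fun s hs => ?_
    by_contra! hsb
    have has : a < s := by
      rcases lt_trichotomy s a with h1 | h1 | h1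
      · exact absurd (hlt s h1) hs.2
      · exact absurd (h1 ▸ hxa) hs.2
      · exact h1
    have := hMle s ⟨has, hsb.le⟩
    rw [hM0] at this
    exact hs.2 (by simpa using this)
  exact absurd this (not_le.2 hab)

end IsCadlagPath

namespace IsCadlagPath

/-- The finite set of jump times depends on the horizon, so `pathExp` is compared with a different
`jumpExp` on each bounded interval. -/
lemma of_eqOn_Iic {x : ℝ≥0 → ℝ}
    (h : ∀ T, ∃ y : ℝ≥0 → ℝ, IsCadlagPath y ∧ ∀ t ≤ T, x t = y t) : IsCadlagPath x := by
  intro t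
  obtain ⟨y, hy, hxy⟩ := h (t + 1)
  obtain ⟨h1, l, hl⟩ := hy t
  have hev : ∀ᶠ s in 𝓝 t, y s = x s := by
    filter_upwards [Iic_mem_nhds (show t < t + 1 by simp)] with s hs using (hxy s hs).symm
  refine ⟨?_, l, hl.congr' (hev.filter_mono nhdsWithin_le_nhds)⟩
  exact h1.congr_of_eventuallyEq
    ((hev.filter_mono nhdsWithin_le_nhds).mono fun _ h => h.symm) (hxy t (by simp))

lemma leftLim_congr {x y : ℝ≥0 → ℝ} {t : ℝ≥0} (ht : 0 < t) (hy : IsCadlagPath y)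
    (hxy : ∀ s < t, x s = y s) : Function.leftLim x t = Function.leftLim y t := by
  have := nhdsLT_neBot_of_exists_lt ⟨0, ht⟩
  refine leftLim_eq_of_tendsto ((hy.tendsto_leftLim t).congr' ?_)
  filter_upwards [self_mem_nhdsWithin] with s hs using (hxy s hs).symm

end IsCadlagPath

/-! ### The exponential driven by finitely many jumps -/

section FiniteJumps

variable (S : Finset ℝ≥0) (f : ℝ≥0 → ℝ)

lemma eventually_filter_le_eq_filter_lt (t : ℝ≥0) :
    ∀ᶠ r in 𝓝[<] t, S.filter (· ≤ r) = S.filter (· < t) := by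
  have h : ∀ s ∈ S, ∀ᶠ r in 𝓝[<] t, (s ≤ r ↔ s < t) := by
    intro s _
    rcases lt_or_ge s t with hst | hst
    · filter_upwards [Ioo_mem_nhdsLT hst] with r hr
      exact ⟨fun _ => hst, fun _ => hr.1.le⟩
    · filter_upwards [self_mem_nhdsWithin] with r hr
      exact ⟨fun h => absurd (hst.trans h) (not_le.2 hr), fun h => absurd hst (not_le.2 h)⟩
  filter_upwards [(Finset.eventually_all S).2 h] with r hr
  exact Finset.filter_congr hr

lemma eventually_filter_le_eq_filter_le (t : ℝ≥0) :
    ∀ᶠ r in 𝓝[≥] t, S.filter (· ≤ r) = S.filter (· ≤ t) := by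
  have h : ∀ s ∈ S, ∀ᶠ r in 𝓝[≥] t, (s ≤ r ↔ s ≤ t) := by
    intro s _
    rcases le_or_gt s t with hst | hst
    · filter_upwards [self_mem_nhdsWithin] with r hr
      exact ⟨fun _ => hst, fun h => h.trans hr⟩
    · filter_upwards [mem_nhdsWithin_of_mem_nhds (Iio_mem_nhds hst)] with r hr
      exact ⟨fun h => absurd h (not_le.2 hr), fun h => absurd h (not_le.2 hst)⟩
  filter_upwards [(Finset.eventually_all S).2 h] with r hr
  exact Finset.filter_congr hr

/-- The Doléans-Dade exponential of `∑ s ∈ S with s ≤ t, f s - ∫_0^t f ds`. -/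
def jumpExp (t : ℝ≥0) : ℝ := Real.exp (-timeInt f t) * ∏ s ∈ S with s ≤ t, (1 + f s)

/-- The left limits of `jumpExp`. -/
def jumpExpLeft (t : ℝ≥0) : ℝ := Real.exp (-timeInt f t) * ∏ s ∈ S with s < t, (1 + f s)

variable {f} (hf : ∀ t, IntegrableOn f (Set.Ioc 0 t) lebesgue)
include hf

lemma tendsto_jumpExp_nhdsLT (t : ℝ≥0) :
    Tendsto (jumpExp S f) (𝓝[<] t) (𝓝 (jumpExpLeft S f t)) := by
  have h1 : Tendsto (fun r => Real.exp (-timeInt f r)) (𝓝[<] t) (𝓝 (Real.exp (-timeInt f t))) :=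
    ((Real.continuous_exp.comp (continuous_timeInt hf).neg).tendsto t).mono_left
      nhdsWithin_le_nhds
  refine (h1.mul_const _).congr' ?_
  filter_upwards [eventually_filter_le_eq_filter_lt S t] with r hr
  rw [jumpExp, hr]

lemma isCadlagPath_jumpExp : IsCadlagPath (jumpExp S f) := by
  intro t
  refine ⟨?_, _, tendsto_jumpExp_nhdsLT S hf t⟩
  have h1 : Tendsto (fun r => Real.exp (-timeInt f r)) (𝓝[≥] t) (𝓝 (Real.exp (-timeInt f t))) :=
    ((Real.continuous_exp.comp (continuous_timeInt hf).neg).tendsto t).mono_left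
      nhdsWithin_le_nhds
  refine (h1.mul_const _).congr' ?_
  filter_upwards [eventually_filter_le_eq_filter_le S t] with r hr
  rw [jumpExp, hr]

lemma leftLim_jumpExp {t : ℝ≥0} (ht : 0 < t) :
    Function.leftLim (jumpExp S f) t = jumpExpLeft S f t := by
  have := nhdsLT_neBot_of_exists_lt ⟨0, ht⟩
  exact leftLim_eq_of_tendsto (tendsto_jumpExp_nhdsLT S hf t)

lemma integrableOn_mul_jumpExpLeft (t : ℝ≥0) :
    IntegrableOn (fun s => f s * jumpExpLeft S f s) (Set.Ioc 0 t) lebesgue := by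
  refine ((isCadlagPath_jumpExp S hf).integrableOn_mul_leftLim (hf t)).congr_fun
    (fun s hs => ?_) measurableSet_Ioc
  simp only [leftLim_jumpExp S hf hs.1]

/-- Induction on the last jump `b`: adding it changes nothing before `b` and multiplies everything
after by `1 + f b`. With no jumps the claim is `exp_neg_timeInt`. -/
lemma jumpExp_eq_add_integral (t : ℝ≥0) :
    jumpExp S f t = 1 + ((∑ s ∈ S with s ≤ t, f s * jumpExpLeft S f s)
      - ∫ s in Set.Ioc 0 t, f s * jumpExpLeft S f s ∂lebesgue) := by
  induction S using Finset.induction_on_max generalizing t with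
  | empty =>
    simp only [jumpExp, jumpExpLeft, Finset.filter_empty, Finset.prod_empty, mul_one,
      Finset.sum_empty, zero_sub]
    rw [exp_neg_timeInt hf]
    ring
  | insert b S hb ih =>
    have hbS : b ∉ S := fun h => lt_irrefl _ (hb b h)
    have hleft : ∀ s ≤ b, jumpExpLeft (insert b S) f s = jumpExpLeft S f s := by
      intro s hs
      simp only [jumpExpLeft, Finset.filter_insert, not_lt.2 hs, if_false]
    have hright : ∀ s, b < s → jumpExpLeft (insert b S) f s = jumpExpLeft S f s * (1 + f b) := by
      intro s hs
      rw [jumpExpLeft, Finset.filter_insert, if_pos hs, Finset.prod_insert (by simp [hbS]),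
        jumpExpLeft]
      ring
    rcases lt_or_ge t b with htb | hbt
    · have h1 : (insert b S).filter (· ≤ t) = S.filter (· ≤ t) := by
        rw [Finset.filter_insert, if_neg (not_le.2 htb)]
      rw [jumpExp, h1, ← jumpExp, ih t]
      congr 2
      · refine Finset.sum_congr rfl fun s hs => ?_
        rw [hleft s (hb s (Finset.mem_filter.1 hs).1).le]
      · refine setIntegral_congr_fun measurableSet_Ioc fun s hs => ?_
        simp only [hleft s (hs.2.trans htb.le)]
    · have hSt : ∀ r, b ≤ r → S.filter (· ≤ r) = S := fun r hr =>
        Finset.filter_true_of_mem fun s hs => (hb s hs).le.trans hr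
      have hE : jumpExp (insert b S) f t = jumpExp S f t * (1 + f b) := by
        rw [jumpExp, Finset.filter_insert, if_pos hbt, Finset.prod_insert (by simp [hbS]), jumpExp]
        ring
      have hLb : jumpExpLeft S f b = jumpExp S f b := by
        rw [jumpExp, jumpExpLeft, hSt b le_rfl, Finset.filter_true_of_mem hb]
      have hsum : ∑ s ∈ insert b S with s ≤ t, f s * jumpExpLeft (insert b S) f s
          = f b * jumpExp S f b + ∑ s ∈ S, f s * jumpExpLeft S f s := by
        rw [Finset.filter_insert, if_pos hbt, Finset.sum_insert (by simp [hbS]), hSt t hbt,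
          hleft b le_rfl, hLb]
        congr 1
        exact Finset.sum_congr rfl fun s hs => by rw [hleft s (hb s hs).le]
      have hsplit : ∀ g : ℝ≥0 → ℝ, IntegrableOn g (Set.Ioc 0 t) lebesgue →
          ∫ s in Set.Ioc 0 t, g s ∂lebesgue
            = (∫ s in Set.Ioc 0 b, g s ∂lebesgue) + ∫ s in Set.Ioc b t, g s ∂lebesgue := by
        intro g hg
        rw [← setIntegral_union _ measurableSet_Ioc
          (hg.mono_set (Set.Ioc_subset_Ioc_right hbt))
          (hg.mono_set (Set.Ioc_subset_Ioc_left zero_le)),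
          Set.Ioc_union_Ioc_eq_Ioc zero_le hbt]
        exact Set.disjoint_left.2 fun s hs hs' => absurd hs.2 (not_le.2 hs'.1)
      have hint1 : ∫ s in Set.Ioc 0 b, f s * jumpExpLeft (insert b S) f s ∂lebesgue
          = ∫ s in Set.Ioc 0 b, f s * jumpExpLeft S f s ∂lebesgue :=
        setIntegral_congr_fun measurableSet_Ioc fun s hs => by simp only [hleft s hs.2]
      have hint2 : ∫ s in Set.Ioc b t, f s * jumpExpLeft (insert b S) f s ∂lebesgue
          = (∫ s in Set.Ioc b t, f s * jumpExpLeft S f s ∂lebesgue) * (1 + f b) := by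
        rw [← integral_mul_const]
        exact setIntegral_congr_fun measurableSet_Ioc fun s hs => by
          simp only [hright s hs.1, mul_assoc]
      have iht := ih t
      have ihb := ih b
      rw [hSt t hbt, hsplit _ (integrableOn_mul_jumpExpLeft S hf t)] at iht
      rw [hSt b le_rfl] at ihb
      rw [hE, hsum, hsplit _ (integrableOn_mul_jumpExpLeft (insert b S) hf t), hint1, hint2]
      -- The old equation at `t` is scaled by `1 + f b`; subtracting `f b` times the old equation at
      -- `b` undoes the scaling on `(0, b]` and produces the new jump term.
      linear_combination (1 + f b) * iht - f b * ihb

end FiniteJumps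

/-! ### Simple counting measures -/

/-- The restriction of `μ` to `(0, ∞)` is a locally finite simple point measure. -/
structure IsSimpleCounting (μ : Measure ℝ≥0) : Prop where
  integer_valued : ∀ B : Set ℝ≥0, MeasurableSet B → ∃ n : ℕ∞, μ B = (n : ℝ≥0∞)
  finite : ∀ t, μ (Set.Ioc 0 t) < ∞
  simple : ∀ s, 0 < s → μ {s} ≤ 1

lemma eq_zero_or_one_le_of_integer {a : ℝ≥0∞} (h : ∃ n : ℕ∞, a = (n : ℝ≥0∞)) : a = 0 ∨ 1 ≤ a := by
  obtain ⟨n, rfl⟩ := h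
  rcases eq_or_ne n 0 with rfl | hn
  · simp
  · right
    exact_mod_cast Order.one_le_iff_ne_zero.2 hn

namespace IsSimpleCounting

variable {μ : Measure ℝ≥0} (hμ : IsSimpleCounting μ)
include hμ

/-- Integrality leaves no diffuse part: a point of mass zero has small balls of measure below `1`,
hence of measure `0`, so the complement of the atoms is locally null. Finite total mass leaves
finitely many atoms, each of mass `1`. -/
lemma exists_restrict_eq_sum_dirac (T : ℝ≥0) :
    ∃ S : Finset ℝ≥0, (∀ s, s ∈ S ↔ 0 < s ∧ s ≤ T ∧ μ {s} = 1) ∧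
      μ.restrict (Set.Ioc 0 T) = ∑ s ∈ S, Measure.dirac s := by
  set ρ := μ.restrict (Set.Ioc 0 T) with hρ
  have : IsFiniteMeasure ρ := ⟨by simpa [hρ] using hμ.finite T⟩
  have hint : ∀ B, MeasurableSet B → ρ B = 0 ∨ 1 ≤ ρ B := fun B hB => by
    rw [hρ, Measure.restrict_apply hB]
    exact eq_zero_or_one_le_of_integer (hμ.integer_valued _ (hB.inter measurableSet_Ioc))
  have hfin : {s | 1 ≤ ρ {s}}.Finite :=
    Measure.finite_const_le_meas_of_disjoint_iUnion ρ (As := fun s : ℝ≥0 => {s}) one_pos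
      (fun s => measurableSet_singleton s)
      (fun s t hst => by simpa [Function.onFun] using hst) (measure_ne_top _ _)
  have hsing : ∀ s, 0 < s → s ≤ T → ρ {s} = μ {s} := fun s h0 hT => by
    rw [hρ, Measure.restrict_apply (measurableSet_singleton s),
      Set.inter_eq_left.2 (Set.singleton_subset_iff.2 (Set.mem_Ioc.2 ⟨h0, hT⟩))]
  have hmem : ∀ s, s ∈ hfin.toFinset ↔ 0 < s ∧ s ≤ T ∧ μ {s} = 1 := by
    intro s
    rw [Set.Finite.mem_toFinset, Set.mem_ofPred_eq]
    by_cases hs : s ∈ Set.Ioc 0 T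
    · rw [hsing s hs.1 hs.2]
      exact ⟨fun h => ⟨hs.1, hs.2, le_antisymm (hμ.simple s hs.1) h⟩, fun h => h.2.2.ge⟩
    · have : ρ {s} = 0 := by
        rw [hρ, Measure.restrict_apply (measurableSet_singleton s),
          Set.singleton_inter_eq_empty.2 hs, measure_empty]
      rw [this]
      exact ⟨fun h => absurd h (by simp), fun h => absurd ⟨h.1, h.2.1⟩ hs⟩
  refine ⟨hfin.toFinset, hmem, ?_⟩
  have hnull : ρ (hfin.toFinset : Set ℝ≥0)ᶜ = 0 := by
    refine measure_null_of_locally_null _ fun x hx => ?_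
    have hx0 : ρ {x} = 0 := by
      refine (hint _ (measurableSet_singleton x)).resolve_right fun h => hx ?_
      simpa using h
    obtain ⟨n, hn⟩ : ∃ n : ℕ, ρ (Metric.closedBall x (1 / ((n : ℝ) + 1))) < 1 := by
      have hlim := tendsto_measure_iInter_atTop (μ := ρ)
        (s := fun n : ℕ => Metric.closedBall x (1 / ((n : ℝ) + 1)))
        (fun n => measurableSet_closedBall.nullMeasurableSet)
        (fun m n hmn => Metric.closedBall_subset_closedBall (Nat.one_div_le_one_div hmn))
        ⟨0, measure_ne_top _ _⟩
      have hI : ⋂ n : ℕ, Metric.closedBall x (1 / ((n : ℝ) + 1)) = {x} := by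
        ext y
        simp only [Set.mem_iInter, Metric.mem_closedBall, Set.mem_singleton_iff]
        refine ⟨fun h => ?_, fun h n => by rw [h, dist_self]; positivity⟩
        exact dist_le_zero.1 (ge_of_tendsto' tendsto_one_div_add_atTop_nhds_zero_nat h)
      rw [hI, hx0] at hlim
      exact (hlim.eventually_lt_const one_pos).exists
    refine ⟨Metric.closedBall x (1 / ((n : ℝ) + 1)),
      mem_nhdsWithin_of_mem_nhds (Metric.closedBall_mem_nhds x Nat.one_div_pos_of_nat), ?_⟩
    exact (hint _ measurableSet_closedBall).resolve_right (not_le.2 hn)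
  ext B hB
  classical
  rw [Measure.finsetSum_apply, ← measure_inter_add_sdiff B hfin.toFinset.measurableSet,
    measure_mono_null (s := B \ hfin.toFinset) (fun x hx => hx.2) hnull, add_zero]
  have h1 : B ∩ hfin.toFinset = (hfin.toFinset.filter (· ∈ B) : Finset ℝ≥0) := by
    ext s; simp [and_comm]
  rw [h1, ← sum_measure_singleton, Finset.sum_filter]
  refine Finset.sum_congr rfl fun s hs => ?_
  obtain ⟨h0, hT, hs1⟩ := (hmem s).1 hs
  by_cases hsB : s ∈ B <;> simp [hsB, hsing s h0 hT, hs1]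

lemma exists_jumpTimes (T : ℝ≥0) :
    ∃ S : Finset ℝ≥0, (∀ s, s ∈ S ↔ 0 < s ∧ s ≤ T ∧ μ {s} = 1) ∧
      ∀ t ≤ T, μ.restrict (Set.Ioc 0 t) = ∑ s ∈ S with s ≤ t, Measure.dirac s := by
  obtain ⟨S, hS, -⟩ := hμ.exists_restrict_eq_sum_dirac T
  refine ⟨S, hS, fun t ht => ?_⟩
  obtain ⟨S', hS', h⟩ := hμ.exists_restrict_eq_sum_dirac t
  have : S.filter (· ≤ t) = S' := by
    ext s
    rw [Finset.mem_filter, hS, hS']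
    exact ⟨fun h => ⟨h.1.1, h.2, h.1.2.2⟩, fun h => ⟨⟨h.1, h.2.1.trans ht, h.2.2⟩, h.2.1⟩⟩
  rw [this, h]

/-- No measurability of `g` is needed, the measure being a finite sum of Dirac masses. -/
lemma integrableOn (g : ℝ≥0 → ℝ) (t : ℝ≥0) : IntegrableOn g (Set.Ioc 0 t) μ := by
  obtain ⟨S, -, h⟩ := hμ.exists_restrict_eq_sum_dirac t
  rw [IntegrableOn, h, integrable_finsetSum_measure]
  exact fun s _ => integrable_dirac (by simp)

end IsSimpleCounting

lemma integral_sum_dirac (S : Finset ℝ≥0) (g : ℝ≥0 → ℝ) :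
    ∫ s, g s ∂(∑ s ∈ S, Measure.dirac s) = ∑ s ∈ S, g s := by
  rw [integral_finsetSum_measure fun s _ => integrable_dirac (by simp)]
  simp

/-! ### The Doléans-Dade equation along a path -/

/-- The integral of `g` over `(0, t]` against `μ - ds`. -/
def pathInt (μ : Measure ℝ≥0) (g : ℝ≥0 → ℝ) (t : ℝ≥0) : ℝ :=
  (∫ s in Set.Ioc 0 t, g s ∂μ) - ∫ s in Set.Ioc 0 t, g s ∂lebesgue

/-- The explicit solution of the Doléans-Dade equation along a path. -/
def pathExp (μ : Measure ℝ≥0) (f : ℝ≥0 → ℝ) (t : ℝ≥0) : ℝ :=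
  Real.exp ((∫ s in Set.Ioc 0 t, Real.log (1 + f s) ∂μ) - timeInt f t)

lemma pathExp_pos (μ : Measure ℝ≥0) (f : ℝ≥0 → ℝ) (t : ℝ≥0) : 0 < pathExp μ f t :=
  Real.exp_pos _

namespace IsSimpleCounting

variable {μ : Measure ℝ≥0} {f : ℝ≥0 → ℝ}

lemma jump_pathInt (hμ : IsSimpleCounting μ)
    (hf : ∀ t, IntegrableOn f (Set.Ioc 0 t) lebesgue) {t : ℝ≥0} (ht : 0 < t) (hμt : μ {t} = 1) :
    jump (pathInt μ f) t = f t := by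
  obtain ⟨S, hS, hres⟩ := hμ.exists_jumpTimes t
  have htS : t ∈ S := (hS t).2 ⟨ht, le_rfl, hμt⟩
  have hval : ∀ r ≤ t, pathInt μ f r = ∑ s ∈ S with s ≤ r, f s - timeInt f r := by
    intro r hr
    rw [pathInt, hres r hr, integral_sum_dirac, timeInt]
  have hlim : Tendsto (pathInt μ f) (𝓝[<] t) (𝓝 (∑ s ∈ S with s < t, f s - timeInt f t)) := by
    have h1 : Tendsto (fun r => ∑ s ∈ S with s < t, f s - timeInt f r) (𝓝[<] t)
        (𝓝 (∑ s ∈ S with s < t, f s - timeInt f t)) :=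
      tendsto_const_nhds.sub (((continuous_timeInt hf).tendsto t).mono_left nhdsWithin_le_nhds)
    refine h1.congr' ?_
    filter_upwards [eventually_filter_le_eq_filter_lt S t, self_mem_nhdsWithin] with r hr hrt
    rw [hval r (le_of_lt hrt), hr]
  have := nhdsLT_neBot_of_exists_lt ⟨0, ht⟩
  have hins : S.filter (· ≤ t) = insert t (S.filter (· < t)) := by
    ext s
    simp only [Finset.mem_filter, Finset.mem_insert, le_iff_eq_or_lt]
    constructor
    · rintro ⟨h1, h2 | h2⟩
      · exact Or.inl h2
      · exact Or.inr ⟨h1, h2⟩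
    · rintro (rfl | h)
      · exact ⟨htS, Or.inl rfl⟩
      · exact ⟨h.1, Or.inr h.2⟩
  rw [jump, leftLim_eq_of_tendsto hlim, hval t le_rfl, hins, Finset.sum_insert (by simp)]
  ring

/-- Positivity at the atoms turns the exponential of the sum of logarithms into the product of jump
factors. -/
lemma exists_pathExp_eq_jumpExp (hμ : IsSimpleCounting μ)
    (hpos : ∀ s, 0 < s → μ {s} = 1 → 0 < 1 + f s) (T : ℝ≥0) :
    ∃ S : Finset ℝ≥0, (∀ t ≤ T, μ.restrict (Set.Ioc 0 t) = ∑ s ∈ S with s ≤ t, Measure.dirac s) ∧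
      (∀ s ∈ S, 0 < s) ∧ ∀ t ≤ T, pathExp μ f t = jumpExp S f t := by
  obtain ⟨S, hS, hres⟩ := hμ.exists_jumpTimes T
  refine ⟨S, hres, fun s hs => ((hS s).1 hs).1, fun t ht => ?_⟩
  rw [pathExp, hres t ht, integral_sum_dirac, sub_eq_neg_add, Real.exp_add, Real.exp_sum, jumpExp]
  congr 1
  refine Finset.prod_congr rfl fun s hs => Real.exp_log ?_
  have := (hS s).1 (Finset.mem_filter.1 hs).1
  exact hpos s this.1 this.2.2

lemma isCadlagPath_pathExp (hμ : IsSimpleCounting μ)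
    (hf : ∀ t, IntegrableOn f (Set.Ioc 0 t) lebesgue)
    (hpos : ∀ s, 0 < s → μ {s} = 1 → 0 < 1 + f s) : IsCadlagPath (pathExp μ f) :=
  IsCadlagPath.of_eqOn_Iic fun T => by
    obtain ⟨S, -, -, h⟩ := hμ.exists_pathExp_eq_jumpExp hpos T
    exact ⟨_, isCadlagPath_jumpExp S hf, h⟩

lemma pathExp_eq_add_pathInt (hμ : IsSimpleCounting μ)
    (hf : ∀ t, IntegrableOn f (Set.Ioc 0 t) lebesgue)
    (hpos : ∀ s, 0 < s → μ {s} = 1 → 0 < 1 + f s) (t : ℝ≥0) :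
    pathExp μ f t = 1 + pathInt μ (fun s => f s * Function.leftLim (pathExp μ f) s) t := by
  obtain ⟨S, hres, hS0, h⟩ := hμ.exists_pathExp_eq_jumpExp hpos t
  have hleft : ∀ s, 0 < s → s ≤ t → Function.leftLim (pathExp μ f) s = jumpExpLeft S f s := by
    intro s hs hst
    rw [← leftLim_jumpExp S hf hs]
    exact IsCadlagPath.leftLim_congr hs (isCadlagPath_jumpExp S hf)
      fun r hr => h r (hr.le.trans hst)
  rw [h t le_rfl, jumpExp_eq_add_integral S hf, pathInt, hres t le_rfl, integral_sum_dirac]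
  congr 2
  · refine Finset.sum_congr rfl fun s hs => ?_
    rw [Finset.mem_filter] at hs
    rw [hleft s (hS0 s hs.1) hs.2]
  · refine setIntegral_congr_fun measurableSet_Ioc fun s hs => ?_
    simp only [hleft s hs.1 hs.2]

/-- The difference of two solutions solves the homogeneous equation, so the Grönwall principle
applies with the measure `|f| (dμ + ds)`, finite on `(0, T]`. -/
lemma eq_of_eq_add_pathInt (hμ : IsSimpleCounting μ) (hfm : Measurable f)
    (hf : ∀ t, IntegrableOn f (Set.Ioc 0 t) lebesgue) {x y : ℝ≥0 → ℝ}
    (hx : IsCadlagPath x) (hy : IsCadlagPath y)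
    (hxe : ∀ t, x t = 1 + pathInt μ (fun s => f s * Function.leftLim x s) t)
    (hye : ∀ t, y t = 1 + pathInt μ (fun s => f s * Function.leftLim y s) t) (T : ℝ≥0) :
    x T = y T := by
  have hD := hx.sub hy
  set D : ℝ≥0 → ℝ := fun t => x t - y t with hDdef
  have hDe : ∀ t, D t = pathInt μ (fun s => f s * Function.leftLim D s) t := by
    intro t
    have key : ∀ ρ : Measure ℝ≥0, IntegrableOn f (Set.Ioc 0 t) ρ →
        ∫ s in Set.Ioc 0 t, f s * Function.leftLim D s ∂ρ
          = (∫ s in Set.Ioc 0 t, f s * Function.leftLim x s ∂ρ)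
            - ∫ s in Set.Ioc 0 t, f s * Function.leftLim y s ∂ρ := by
      intro ρ hρ
      rw [← integral_sub (hx.integrableOn_mul_leftLim hρ) (hy.integrableOn_mul_leftLim hρ)]
      refine setIntegral_congr_fun measurableSet_Ioc fun s hs => ?_
      simp only [hDdef, hx.leftLim_sub hy hs.1, mul_sub]
    rw [pathInt, key μ (hμ.integrableOn f t), key lebesgue (hf t)]
    simp only [hDdef]
    rw [hxe t, hye t, pathInt, pathInt]
    ring
  have hfe : Measurable fun s => ‖f s‖ₑ := hfm.enorm
  set ν := (μ + lebesgue).withDensity fun s => ‖f s‖ₑ with hν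
  have hνT : ν (Set.Ioc 0 T) < ∞ := by
    rw [hν, withDensity_apply _ measurableSet_Ioc, Measure.restrict_add, lintegral_add_measure,
      ENNReal.add_lt_top]
    exact ⟨(hμ.integrableOn f T).2, (hf T).2⟩
  have h0 := hD.eq_zero_of_enorm_le hνT (fun t _ => ?_) T le_rfl
  · simpa [hDdef, sub_eq_zero] using h0
  · rw [hν, setLIntegral_withDensity_eq_setLIntegral_mul _ hfe hD.measurable_leftLim.enorm
      measurableSet_Ioc, Measure.restrict_add, lintegral_add_measure, hDe t, pathInt]
    refine (enorm_sub_le).trans (add_le_add ?_ ?_)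
    all_goals
      refine (enorm_integral_le_lintegral_enorm _).trans (le_of_eq ?_)
      simp only [Pi.mul_apply, enorm_mul]

lemma eq_pathExp (hμ : IsSimpleCounting μ) (hfm : Measurable f)
    (hf : ∀ t, IntegrableOn f (Set.Ioc 0 t) lebesgue)
    (hpos : ∀ s, 0 < s → μ {s} = 1 → 0 < 1 + f s) {x : ℝ≥0 → ℝ} (hx : IsCadlagPath x)
    (hxe : ∀ t, x t = 1 + pathInt μ (fun s => f s * Function.leftLim x s) t) (t : ℝ≥0) :
    x t = pathExp μ f t :=
  hμ.eq_of_eq_add_pathInt hfm hf hx (hμ.isCadlagPath_pathExp hf hpos) hxe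
    (hμ.pathExp_eq_add_pathInt hf hpos) t

end IsSimpleCounting

/-- If `f ≠ -1` almost everywhere and at every atom, the reciprocal of the exponential of `f` is,
up to an absolutely continuous factor, the exponential of `-f / (1 + f)`. -/
lemma pathExp_inv {μ : Measure ℝ≥0} {f : ℝ≥0 → ℝ}
    (hf : ∀ t, IntegrableOn f (Set.Ioc 0 t) lebesgue)
    (hg : ∀ t, IntegrableOn (fun s => -f s / (1 + f s)) (Set.Ioc 0 t) lebesgue)
    (hμ : IsSimpleCounting μ) (hpos : ∀ s, 0 < s → μ {s} = 1 → 0 < 1 + f s)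
    (hne : ∀ᵐ s ∂lebesgue, 0 < s → 1 + f s ≠ 0) (t : ℝ≥0) :
    IntegrableOn (fun s => f s ^ 2 / (1 + f s)) (Set.Ioc 0 t) lebesgue ∧
    (pathExp μ f t)⁻¹ = Real.exp (∫ s in Set.Ioc 0 t, f s ^ 2 / (1 + f s) ∂lebesgue)
      * pathExp μ (fun s => -f s / (1 + f s)) t := by
  -- With `x / 0 = 0` this fails where `f = -1` (`-1` against `0`), hence the need for `hne`.
  have hae : (fun s => f s + -f s / (1 + f s)) =ᵐ[lebesgue.restrict (Set.Ioc 0 t)]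
      fun s => f s ^ 2 / (1 + f s) := by
    filter_upwards [ae_restrict_mem measurableSet_Ioc, ae_restrict_of_ae hne] with s hs hns
    have := hns hs.1
    field_simp
    ring
  refine ⟨((hf t).add (hg t)).congr hae, ?_⟩
  obtain ⟨S, hS, hres⟩ := hμ.exists_jumpTimes t
  have hlog : ∫ s in Set.Ioc 0 t, Real.log (1 + -f s / (1 + f s)) ∂μ
      = -∫ s in Set.Ioc 0 t, Real.log (1 + f s) ∂μ := by
    rw [hres t le_rfl, integral_sum_dirac, integral_sum_dirac, ← Finset.sum_neg_distrib]
    refine Finset.sum_congr rfl fun s hs => ?_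
    have h1 := (hS s).1 (Finset.mem_filter.1 hs).1
    have h2 := hpos s h1.1 h1.2.2
    rw [← Real.log_inv]
    congr 1
    field_simp
    ring
  rw [pathExp, pathExp, ← Real.exp_neg, ← Real.exp_add, hlog, ← integral_congr_ae hae,
    integral_add (hf t) (hg t), timeInt, timeInt]
  congr 1
  ring

/-! ### The Poisson law -/

lemma poissonMeasure_singleton_succ_mul (r : ℝ≥0) (k : ℕ) :
    ((k + 1 : ℕ) : ℝ≥0∞) * poissonMeasure r {k + 1} = r * poissonMeasure r {k} := by
  rw [poissonMeasure_singleton, poissonMeasure_singleton, ← ENNReal.ofReal_coe_nnreal,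
    ← ENNReal.ofReal_natCast, ← ENNReal.ofReal_mul (by positivity),
    ← ENNReal.ofReal_mul (by positivity)]
  congr 1
  rw [Nat.factorial_succ]
  push_cast
  field_simp
  exact pow_succ' _ _

lemma tsum_poissonMeasure_singleton (r : ℝ≥0) : ∑' k, poissonMeasure r {k} = 1 := by
  have h := measure_biUnion (μ := poissonMeasure r) (s := Set.univ) (f := fun k : ℕ => {k})
    Set.countable_univ (fun i _ j _ hij => by simpa [Function.onFun] using hij)
    (fun _ _ => measurableSet_singleton _)
  rw [Set.biUnion_of_singleton, measure_univ] at h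
  rw [h, tsum_univ (fun k : ℕ => poissonMeasure r {k})]

lemma lintegral_natCast_poissonMeasure (r : ℝ≥0) :
    ∫⁻ k, (k : ℝ≥0∞) ∂poissonMeasure r = r := by
  rw [lintegral_countable', tsum_eq_zero_add' ENNReal.summable]
  simp only [poissonMeasure_singleton_succ_mul, ENNReal.tsum_mul_left,
    tsum_poissonMeasure_singleton]
  simp

lemma poissonMeasure_two_le (r : ℝ≥0) : poissonMeasure r {k | 2 ≤ k} ≤ (r : ℝ≥0∞) ^ 2 := by
  have h1 : {k : ℕ | 2 ≤ k} = ({0, 1} : Set ℕ)ᶜ := by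
    ext k; simp; omega
  have h2 : (poissonMeasure r).real {0, 1} = Real.exp (-r) + Real.exp (-r) * r := by
    rw [← Set.union_singleton, Set.union_comm, measureReal_union (by simp) (by simp),
      poissonMeasure_real_singleton, poissonMeasure_real_singleton]
    simp
  have h3 : (poissonMeasure r).real {k | 2 ≤ k} ≤ (r : ℝ) ^ 2 := by
    rw [h1, probReal_compl_eq_one_sub (by measurability), h2]
    -- From `exp (-r) ≥ 1 - r` follows `1 - exp (-r) (1 + r) ≤ 1 - (1 - r) (1 + r) = r ^ 2`.
    have h4 := Real.add_one_le_exp (-(r : ℝ))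
    have h5 := r.coe_nonneg
    nlinarith
  rw [← ENNReal.ofReal_toReal (measure_ne_top (poissonMeasure r) {k | 2 ≤ k}),
    ← ENNReal.ofReal_coe_nnreal, ← ENNReal.ofReal_pow r.coe_nonneg]
  exact ENNReal.ofReal_le_ofReal h3

/-! ### Sample paths of the Poisson process -/

namespace IsStandardPoisson

variable {Ω : Type*} [mΩ : MeasurableSpace Ω] {P : Measure Ω} {ℱ : Filtration ℝ≥0 mΩ}
  {ξ : Ω → Measure ℝ≥0}

lemma measurable_apply (hξ : IsStandardPoisson P ℱ ξ) {t : ℝ≥0} {B : Set ℝ≥0}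
    (hB : MeasurableSet B) (hBt : B ⊆ Set.Iic t) : Measurable fun ω => ξ ω B :=
  (hξ.adapted t B hB hBt).mono (ℱ.le t) le_rfl

variable [IsProbabilityMeasure P]

/-- The Poisson weights sum to `1`, leaving no probability for the value `∞`. -/
lemma ae_eq_natCast (hξ : IsStandardPoisson P ℱ ξ) {t : ℝ≥0} {B : Set ℝ≥0}
    (hB : MeasurableSet B) (hBt : B ⊆ Set.Iic t) (hB' : lebesgue B < ∞) :
    ∀ᵐ ω ∂P, ∃ k : ℕ, ξ ω B = k := by
  have hm := hξ.measurable_apply hB hBt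
  have hme : ∀ k : ℕ, MeasurableSet {ω | ξ ω B = k} := fun k => hm (measurableSet_singleton _)
  have hset : {ω | ∃ k : ℕ, ξ ω B = k} = ⋃ k : ℕ, {ω | ξ ω B = k} := by
    ext ω; simp
  have hP : P {ω | ∃ k : ℕ, ξ ω B = k} = 1 := by
    rw [hset, measure_iUnion _ hme]
    · simp only [hξ.law B hB hB', tsum_poissonMeasure_singleton]
    · intro i j hij
      refine Set.disjoint_left.2 fun ω hi hj => hij ?_
      have : (i : ℝ≥0∞) = j := (show ξ ω B = i from hi).symm.trans hj
      exact_mod_cast this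
  exact (prob_compl_eq_zero_iff (hset ▸ MeasurableSet.iUnion hme)).2 hP

lemma map_floor (hξ : IsStandardPoisson P ℱ ξ) {t : ℝ≥0} {B : Set ℝ≥0}
    (hB : MeasurableSet B) (hBt : B ⊆ Set.Iic t) (hB' : lebesgue B < ∞) :
    ∃ N : Ω → ℕ, Measurable N ∧ (∀ᵐ ω ∂P, ξ ω B = N ω) ∧
      P.map N = poissonMeasure (lebesgue B).toNNReal := by
  have hN : Measurable fun ω => ⌊(ξ ω B).toNNReal⌋₊ :=
    Nat.measurable_floor.comp (hξ.measurable_apply hB hBt).ennreal_toNNReal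
  have hae : ∀ᵐ ω ∂P, ξ ω B = (⌊(ξ ω B).toNNReal⌋₊ : ℝ≥0∞) := by
    filter_upwards [hξ.ae_eq_natCast hB hBt hB'] with ω ⟨k, hk⟩
    simp [hk]
  refine ⟨_, hN, hae, ?_⟩
  rw [Measure.ext_iff_singleton]
  intro k
  rw [Measure.map_apply hN (measurableSet_singleton _), ← hξ.law B hB hB' k]
  refine measure_congr ?_
  filter_upwards [hae] with ω hω
  refine propext ⟨fun h => ?_, fun h => ?_⟩
  · exact hω.trans (congrArg (fun n : ℕ => (n : ℝ≥0∞)) h)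
  · exact Nat.cast_injective (R := ℝ≥0∞) (hω.symm.trans h)

lemma lintegral_apply (hξ : IsStandardPoisson P ℱ ξ) {t : ℝ≥0} {B : Set ℝ≥0}
    (hB : MeasurableSet B) (hBt : B ⊆ Set.Iic t) (hB' : lebesgue B < ∞) :
    ∫⁻ ω, ξ ω B ∂P = lebesgue B := by
  obtain ⟨N, hN, hae, hmap⟩ := hξ.map_floor hB hBt hB'
  rw [lintegral_congr_ae hae, ← lintegral_map (f := fun k : ℕ => (k : ℝ≥0∞))
    (measurable_of_countable _) hN, hmap, lintegral_natCast_poissonMeasure,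
    ENNReal.coe_toNNReal hB'.ne]

lemma measure_two_le (hξ : IsStandardPoisson P ℱ ξ) {t : ℝ≥0} {B : Set ℝ≥0}
    (hB : MeasurableSet B) (hBt : B ⊆ Set.Iic t) (hB' : lebesgue B < ∞) :
    P {ω | 2 ≤ ξ ω B} ≤ lebesgue B ^ 2 := by
  obtain ⟨N, hN, hae, hmap⟩ := hξ.map_floor hB hBt hB'
  have h1 : P {ω | 2 ≤ ξ ω B} = P (N ⁻¹' {k | 2 ≤ k}) := by
    refine measure_congr ?_
    filter_upwards [hae] with ω hω
    refine propext ?_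
    change 2 ≤ ξ ω B ↔ 2 ≤ N ω
    rw [hω]
    exact_mod_cast Iff.rfl
  rw [h1, ← Measure.map_apply hN (by measurability), hmap]
  refine (poissonMeasure_two_le _).trans ?_
  rw [ENNReal.coe_toNNReal hB'.ne]

/-- Cut `(0, m]` into `m (n + 1)` intervals of length `1 / (n + 1)`. A multiple atom puts two points
in one of them, which has probability at most `m (n + 1) / (n + 1)²`, tending to `0`. -/
lemma measure_exists_atom (hξ : IsStandardPoisson P ℱ ξ) (m : ℕ) :
    P {ω | ∃ s : ℝ≥0, 0 < s ∧ s ≤ m ∧ 2 ≤ ξ ω {s}} = 0 := by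
  have hbound : ∀ n : ℕ, P {ω | ∃ s : ℝ≥0, 0 < s ∧ s ≤ m ∧ 2 ≤ ξ ω {s}}
      ≤ (m : ℝ≥0∞) * ((n + 1 : ℕ) : ℝ≥0∞)⁻¹ := by
    intro n
    set I : ℕ → Set ℝ≥0 := fun i => Set.Ioc ((i : ℝ≥0) / (n + 1)) ((i + 1 : ℕ) / (n + 1)) with hI
    have hn : (0 : ℝ≥0) < n + 1 := by positivity
    have hIleb : ∀ i, lebesgue (I i) = ((n + 1 : ℕ) : ℝ≥0∞)⁻¹ := by
      intro i
      have h1 : ((i + 1 : ℕ) : ℝ≥0) / (n + 1) - (i : ℝ≥0) / (n + 1) = ((n + 1 : ℕ) : ℝ≥0)⁻¹ := by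
        rw [← NNReal.sub_div]
        push_cast
        rw [add_tsub_cancel_left, one_div]
      rw [hI, lebesgue_Ioc, h1, ENNReal.coe_inv (by positivity), ENNReal.coe_natCast]
    have hsub : {ω | ∃ s : ℝ≥0, 0 < s ∧ s ≤ m ∧ 2 ≤ ξ ω {s}}
        ⊆ ⋃ i ∈ Finset.range (m * (n + 1)), {ω | 2 ≤ ξ ω (I i)} := by
      rintro ω ⟨s, hs0, hsm, hs⟩
      simp only [Set.mem_iUnion, Finset.mem_range]
      have hpos : 0 < ⌈s * (n + 1)⌉₊ := Nat.ceil_pos.2 (mul_pos hs0 hn)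
      refine ⟨⌈s * (n + 1)⌉₊ - 1, ?_, hs.trans (measure_mono (Set.singleton_subset_iff.2 ?_))⟩
      · have : ⌈s * (n + 1)⌉₊ ≤ m * (n + 1) := by
          refine Nat.ceil_le.2 ?_
          push_cast
          gcongr
        omega
      · refine ⟨?_, ?_⟩
        · rw [div_lt_iff₀ hn]
          exact Nat.lt_ceil.1 (by omega)
        · rw [le_div_iff₀ hn, Nat.sub_add_cancel hpos]
          exact Nat.le_ceil _
    calc P {ω | ∃ s : ℝ≥0, 0 < s ∧ s ≤ m ∧ 2 ≤ ξ ω {s}}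
        ≤ P (⋃ i ∈ Finset.range (m * (n + 1)), {ω | 2 ≤ ξ ω (I i)}) := measure_mono hsub
      _ ≤ ∑ i ∈ Finset.range (m * (n + 1)), P {ω | 2 ≤ ξ ω (I i)} :=
        measure_biUnion_finset_le _ _
      _ ≤ ∑ i ∈ Finset.range (m * (n + 1)), (((n + 1 : ℕ) : ℝ≥0∞)⁻¹) ^ 2 := by
        refine Finset.sum_le_sum fun i _ => ?_
        rw [← hIleb i]
        exact hξ.measure_two_le measurableSet_Ioc (fun s hs => hs.2) (lebesgue_Ioc_lt_top _ _)
      _ = (m : ℝ≥0∞) * ((n + 1 : ℕ) : ℝ≥0∞)⁻¹ := by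
        rw [Finset.sum_const, Finset.card_range, nsmul_eq_mul, sq, Nat.cast_mul, mul_assoc,
          ← mul_assoc (((n + 1 : ℕ) : ℝ≥0∞)), ENNReal.mul_inv_cancel
          (by exact_mod_cast n.succ_ne_zero) (ENNReal.natCast_ne_top _), one_mul]
  have hlim : Tendsto (fun n : ℕ => (m : ℝ≥0∞) * ((n + 1 : ℕ) : ℝ≥0∞)⁻¹) atTop (𝓝 (m * 0)) :=
    ENNReal.Tendsto.const_mul
      (ENNReal.tendsto_inv_nat_nhds_zero.comp (tendsto_add_atTop_nat 1))
      (Or.inr (ENNReal.natCast_ne_top _))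
  rw [mul_zero] at hlim
  exact le_antisymm (ge_of_tendsto' hlim hbound) zero_le

lemma ae_isSimpleCounting (hξ : IsStandardPoisson P ℱ ξ) : ∀ᵐ ω ∂P, IsSimpleCounting (ξ ω) := by
  have h1 : ∀ᵐ ω ∂P, ∀ m : ℕ, ∃ k : ℕ, ξ ω (Set.Ioc 0 (m : ℝ≥0)) = k :=
    ae_all_iff.2 fun m =>
      hξ.ae_eq_natCast measurableSet_Ioc (fun s hs => hs.2) (lebesgue_Ioc_lt_top _ _)
  have h2 : ∀ᵐ ω ∂P, ∀ m : ℕ, ¬ ∃ s : ℝ≥0, 0 < s ∧ s ≤ m ∧ 2 ≤ ξ ω {s} :=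
    ae_all_iff.2 fun m => by
      rw [ae_iff]
      simpa only [not_not] using hξ.measure_exists_atom m
  filter_upwards [h1, h2] with ω hω1 hω2
  refine ⟨hξ.integer_valued ω, fun t => ?_, fun s hs => ?_⟩
  · obtain ⟨m, hm⟩ := exists_nat_ge t
    obtain ⟨k, hk⟩ := hω1 m
    refine (measure_mono (Set.Ioc_subset_Ioc_right hm)).trans_lt ?_
    rw [hk]
    exact ENNReal.natCast_lt_top k
  · obtain ⟨m, hm⟩ := exists_nat_ge s
    have hlt : ξ ω {s} < 2 := not_le.1 fun h => hω2 m ⟨s, hs, hm, h⟩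
    obtain ⟨n, hn⟩ := hξ.integer_valued ω {s} (measurableSet_singleton s)
    rw [hn] at hlt ⊢
    have h3 : n < 2 := by exact_mod_cast hlt
    have h4 : n ≤ 1 := Order.le_of_lt_add_one (by simpa [one_add_one_eq_two] using h3)
    exact_mod_cast h4

end IsStandardPoisson

/-! ### The Poisson random measure as a kernel -/

/-- Splitting according to the total mass `n` gives finite kernels, whose sum is s-finite; where the
mass is not a natural number the kernel is zero. This makes integrals against `ξ ω` measurable in
`ω`, for whichever σ-algebra `m` is used. -/
lemma exists_kernel_eq_restrict {Ω : Type*} {m : MeasurableSpace Ω} {ξ : Ω → Measure ℝ≥0}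
    {t : ℝ≥0} (hm : ∀ B : Set ℝ≥0, MeasurableSet B → B ⊆ Set.Iic t → Measurable fun ω => ξ ω B) :
    ∃ κ : Kernel Ω ℝ≥0, IsSFiniteKernel κ ∧
      ∀ ω (k : ℕ), ξ ω (Set.Ioc 0 t) = k → κ ω = (ξ ω).restrict (Set.Ioc 0 t) := by
  classical
  have hset : ∀ n : ℕ, MeasurableSet {ω | ξ ω (Set.Ioc 0 t) = n} := fun n =>
    hm _ measurableSet_Ioc (fun s hs => hs.2) (measurableSet_singleton _)
  let η : ℕ → Kernel Ω ℝ≥0 := fun n =>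
    { toFun := fun ω => if ξ ω (Set.Ioc 0 t) = n then (ξ ω).restrict (Set.Ioc 0 t) else 0
      measurable' := by
        refine Measure.measurable_of_measurable_coe _ fun B hB => ?_
        have h : (fun ω => (if ξ ω (Set.Ioc 0 t) = n then (ξ ω).restrict (Set.Ioc 0 t) else 0) B)
            = fun ω => if ξ ω (Set.Ioc 0 t) = n then ξ ω (B ∩ Set.Ioc 0 t) else 0 := by
          funext ω
          split_ifs
          · rw [Measure.restrict_apply hB]
          · simp
        rw [h]
        exact Measurable.ite (hset n)
          (hm _ (hB.inter measurableSet_Ioc) fun s hs => hs.2.2) measurable_const }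
  have hη : ∀ n ω, η n ω
      = if ξ ω (Set.Ioc 0 t) = n then (ξ ω).restrict (Set.Ioc 0 t) else 0 := fun n ω => rfl
  have hfin : ∀ n, IsFiniteKernel (η n) := fun n => ⟨⟨n, ENNReal.natCast_lt_top n, fun ω => by
    rw [hη]
    split_ifs with h
    · simp [h]
    · simp⟩⟩
  refine ⟨Kernel.sum η, inferInstance, fun ω k hk => ?_⟩
  ext B hB
  rw [Kernel.sum_apply, Measure.sum_apply _ hB, tsum_eq_single k]
  · rw [hη, if_pos hk]
  · intro n hn
    rw [hη, if_neg, Measure.coe_zero, Pi.zero_apply]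
    rw [hk]
    exact fun h => hn (by exact_mod_cast h.symm)

lemma exists_measurable_eq_integral {Ω : Type*} {m : MeasurableSpace Ω} {ξ : Ω → Measure ℝ≥0}
    {t : ℝ≥0} (hm : ∀ B : Set ℝ≥0, MeasurableSet B → B ⊆ Set.Iic t → Measurable fun ω => ξ ω B)
    {F : ℝ≥0 × Ω → ℝ} (hF : Measurable F) :
    ∃ Y : Ω → ℝ, StronglyMeasurable Y ∧ ∀ ω (k : ℕ), ξ ω (Set.Ioc 0 t) = k →
      Y ω = ∫ s in Set.Ioc 0 t, F (s, ω) ∂ξ ω := by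
  obtain ⟨κ, hκ, h⟩ := exists_kernel_eq_restrict hm
  refine ⟨fun ω => ∫ s, F (s, ω) ∂κ ω, ?_, fun ω k hk => by simp only [h ω k hk]⟩
  exact StronglyMeasurable.integral_kernel_prod_right' (κ := κ)
    (f := fun p : Ω × ℝ≥0 => F (p.2, p.1)) (hF.comp measurable_swap).stronglyMeasurable

lemma exists_stronglyMeasurable_eq_pathExp {Ω : Type*} {m : MeasurableSpace Ω}
    {ξ : Ω → Measure ℝ≥0} {t : ℝ≥0}
    (hm : ∀ B : Set ℝ≥0, MeasurableSet B → B ⊆ Set.Iic t → Measurable fun ω => ξ ω B)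
    {f : ℝ≥0 → Ω → ℝ} (hf : Measurable fun p : ℝ≥0 × Ω => f (min p.1 t) p.2) :
    ∃ z : Ω → ℝ, StronglyMeasurable z ∧ ∀ ω (k : ℕ), ξ ω (Set.Ioc 0 t) = k →
      z ω = pathExp (ξ ω) (fun s => f s ω) t := by
  obtain ⟨Y, hY, hYe⟩ := exists_measurable_eq_integral hm
    (F := fun p => Real.log (1 + f (min p.1 t) p.2)) (hf.const_add 1).log
  have hG : StronglyMeasurable fun ω => ∫ s in Set.Ioc 0 t, f (min s t) ω ∂lebesgue :=
    StronglyMeasurable.integral_prod_right'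
      (f := fun p : Ω × ℝ≥0 => f (min p.2 t) p.1) (hf.comp measurable_swap).stronglyMeasurable
  refine ⟨fun ω => Real.exp (Y ω - ∫ s in Set.Ioc 0 t, f (min s t) ω ∂lebesgue),
    Real.continuous_exp.comp_stronglyMeasurable (hY.sub hG), fun ω k hk => ?_⟩
  simp only [hYe ω k hk, pathExp, timeInt]
  congr 2
  all_goals
    exact setIntegral_congr_fun measurableSet_Ioc fun s hs => by simp only [min_eq_left hs.2]

/-! ### Predictable processes -/

section Predictable

variable {Ω : Type*} {mΩ : MeasurableSpace Ω} {ℱ : Filtration ℝ≥0 mΩ} {f : ℝ≥0 → Ω → ℝ}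

lemma predictable_le_prod : ℱ.predictable ≤ (inferInstance : MeasurableSpace (ℝ≥0 × Ω)) :=
  measurableSpace_le_predictable_of_measurableSet
    (fun A hA => (measurableSet_singleton _).prod (ℱ.le _ A hA))
    (fun i A hA => measurableSet_Ioi.prod (ℱ.le i A hA))

lemma measurable_path_of_predictable (hf : IsStronglyPredictable ℱ f) (ω : Ω) :
    Measurable fun s => f s ω :=
  (StronglyMeasurable.mono hf predictable_le_prod).measurable.comp
    (measurable_id.prodMk measurable_const)

/-- Predictable processes are progressive; freezing time at `t` extends this `ℱ t`-measurability
from `[0, t]` to the whole axis. -/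
lemma measurable_min_of_predictable (hf : IsStronglyPredictable ℱ f) (t : ℝ≥0) :
    Measurable[Prod.instMeasurableSpace (m₂ := ℱ t)] fun p : ℝ≥0 × Ω => f (min p.1 t) p.2 := by
  let _ : MeasurableSpace Ω := ℱ t
  have h1 : Measurable fun p : Set.Iic t × Ω => f p.1 p.2 :=
    (hf.isStronglyProgressive t).measurable
  have h2 : Measurable fun p : ℝ≥0 × Ω =>
      ((⟨min p.1 t, Set.mem_Iic.2 (min_le_right _ _)⟩ : Set.Iic t), p.2) :=
    ((measurable_fst.min measurable_const).subtype_mk).prodMk measurable_snd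
  exact h1.comp h2

lemma isStronglyPredictable_neg_div (hf : IsStronglyPredictable ℱ f) :
    IsStronglyPredictable ℱ fun s ω => -f s ω / (1 + f s ω) := by
  have h : Measurable[ℱ.predictable] (Function.uncurry f) := StronglyMeasurable.measurable hf
  have h2 : Measurable[ℱ.predictable] fun p => -Function.uncurry f p / (1 + Function.uncurry f p) :=
    h.neg.div (h.const_add 1)
  exact h2.stronglyMeasurable

end Predictable

lemma IsSimpleCounting.ae_restrict_of_atoms {μ : Measure ℝ≥0} (hμ : IsSimpleCounting μ)
    {p : ℝ≥0 → Prop} (hp : ∀ s, 0 < s → μ {s} = 1 → p s) (t : ℝ≥0) :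
    ∀ᵐ s ∂μ.restrict (Set.Ioc 0 t), p s := by
  obtain ⟨S, hS, hres⟩ := hμ.exists_restrict_eq_sum_dirac t
  rw [hres, ae_iff, Measure.finsetSum_apply]
  refine Finset.sum_eq_zero fun s hs => ?_
  have h1 := (hS s).1 hs
  simpa using hp s h1.1 h1.2.2

/-! ### Existence and uniqueness of the exponential; the compensation formula -/

namespace IsStandardPoisson

variable {Ω : Type*} [mΩ : MeasurableSpace Ω] {P : Measure Ω} {ℱ : Filtration ℝ≥0 mΩ}
  {ξ : Ω → Measure ℝ≥0} [IsProbabilityMeasure P]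

lemma exists_isDoleansDade (hξ : IsStandardPoisson P ℱ ξ) {f : ℝ≥0 → Ω → ℝ}
    (hf : IsIntegrand P ℱ f)
    (hpos : ∀ᵐ ω ∂P, ∀ s, 0 < s → ξ ω {s} = 1 → 0 < 1 + f s ω) :
    ∃ Z, IsDoleansDade P ℱ ξ f Z := by
  -- The filtration is not assumed complete, so `pathExp` is replaced by an exactly adapted version,
  -- equal to it wherever `(0, t]` has finite count.
  have hZ : ∀ t, ∃ z : Ω → ℝ, StronglyMeasurable[ℱ t] z ∧ ∀ ω (k : ℕ), ξ ω (Set.Ioc 0 t) = k →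
      z ω = pathExp (ξ ω) (fun s => f s ω) t := by
    exact fun t => exists_stronglyMeasurable_eq_pathExp (m := ℱ t) (hξ.adapted t)
      (measurable_min_of_predictable hf.predictable t)
  choose Z hZm hZe using hZ
  have hZpath : ∀ᵐ ω ∂P, (fun t => Z t ω) = pathExp (ξ ω) fun s => f s ω := by
    filter_upwards [hξ.ae_isSimpleCounting] with ω hω
    funext t
    obtain ⟨n, hn⟩ := hξ.integer_valued ω _ (measurableSet_Ioc (a := 0) (b := t))
    have hne : n ≠ ⊤ := by
      rintro rfl
      exact (hω.finite t).ne (by simpa using hn)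
    lift n to ℕ using hne
    exact hZe t ω n (by simpa using hn)
  refine ⟨Z, hZm, ?_, ?_⟩
  · filter_upwards [hZpath, hξ.ae_isSimpleCounting, hf.integrable, hpos] with ω h1 h2 h3 h4
    rw [h1]
    exact h2.isCadlagPath_pathExp h3 h4
  · filter_upwards [hZpath, hξ.ae_isSimpleCounting, hf.integrable, hpos] with ω h1 h2 h3 h4 t
    have h5 := h2.pathExp_eq_add_pathInt h3 h4 t
    rw [← h1] at h5
    exact h5

lemma eq_pathExp_of_isDoleansDade (hξ : IsStandardPoisson P ℱ ξ) {f Z : ℝ≥0 → Ω → ℝ}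
    (hf : IsIntegrand P ℱ f)
    (hpos : ∀ᵐ ω ∂P, ∀ s, 0 < s → ξ ω {s} = 1 → 0 < 1 + f s ω)
    (hZ : IsDoleansDade P ℱ ξ f Z) :
    ∀ᵐ ω ∂P, ∀ t, Z t ω = pathExp (ξ ω) (fun s => f s ω) t := by
  filter_upwards [hξ.ae_isSimpleCounting, hf.integrable, hpos, hZ.cadlag, hZ.sde]
    with ω h1 h2 h3 h4 h5 t
  exact h1.eq_pathExp (measurable_path_of_predictable hf.predictable ω) h2 h3 h4 h5 t

/-- The compensation formula: on predictable sets, the Poisson random measure and its intensity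
have the same mean. -/
lemma compProd_apply_predictable (hξ : IsStandardPoisson P ℱ ξ) {T : ℝ≥0} {κ : Kernel Ω ℝ≥0}
    [IsSFiniteKernel κ] (hκ : ∀ᵐ ω ∂P, κ ω = (ξ ω).restrict (Set.Ioc 0 T))
    {B : Set (ℝ≥0 × Ω)} (hB : MeasurableSet[ℱ.predictable] B) :
    (P ⊗ₘ κ) (Prod.swap ⁻¹' B) = (P.prod (lebesgue.restrict (Set.Ioc 0 T))) (Prod.swap ⁻¹' B) := by
  have hle : ∀ C : Set (ℝ≥0 × Ω), MeasurableSet[ℱ.predictable] C →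
      MeasurableSet (Prod.swap ⁻¹' C : Set (Ω × ℝ≥0)) := fun C hC =>
    measurable_swap (predictable_le_prod C hC)
  have hprod : ∀ (A : Set Ω) (C : Set ℝ≥0), MeasurableSet A → MeasurableSet C →
      (P ⊗ₘ κ) (A ×ˢ C) = ∫⁻ ω in A, ξ ω (C ∩ Set.Ioc 0 T) ∂P := by
    intro A C hA hC
    rw [Measure.compProd_apply_prod hA hC]
    refine lintegral_congr_ae (ae_restrict_of_ae ?_)
    filter_upwards [hκ] with ω hω
    rw [hω, Measure.restrict_apply hC]
  have huniv : (P ⊗ₘ κ) Set.univ = (P.prod (lebesgue.restrict (Set.Ioc 0 T))) Set.univ := by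
    rw [← Set.univ_prod_univ, hprod _ _ MeasurableSet.univ MeasurableSet.univ, Measure.prod_prod,
      Measure.restrict_univ, Set.univ_inter, hξ.lintegral_apply measurableSet_Ioc
      (fun s hs => hs.2) (lebesgue_Ioc_lt_top _ _)]
    simp
  have hfin2 : IsFiniteMeasure (lebesgue.restrict (Set.Ioc 0 T)) :=
    ⟨by simpa using lebesgue_Ioc_lt_top 0 T⟩
  have hfin1 : IsFiniteMeasure (P ⊗ₘ κ) := ⟨huniv ▸ measure_lt_top _ _⟩
  -- These rectangles generate the predictable σ-algebra; agreement on them, together with equal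
  -- finite total masses, suffices.
  have hpi : IsPiSystem ({s : Set (ℝ≥0 × Ω) | ∃ A, MeasurableSet[ℱ ⊥] A ∧ s = {⊥} ×ˢ A} ∪
      {s | ∃ i A, MeasurableSet[ℱ i] A ∧ s = Set.Ioi i ×ˢ A}) := by
    have hempty : ∀ (i : ℝ≥0) (A A' : Set Ω),
        ((({⊥} : Set ℝ≥0) ×ˢ A) ∩ (Set.Ioi i ×ˢ A')) = ∅ := by
      rintro i A A'
      rw [Set.prod_inter_prod, Set.singleton_inter_eq_empty.2 (by simp), Set.empty_prod]
    rintro _ (⟨A, hA, rfl⟩ | ⟨i, A, hA, rfl⟩) _ (⟨A', hA', rfl⟩ | ⟨i', A', hA', rfl⟩) hne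
    · exact Or.inl ⟨A ∩ A', hA.inter hA', by rw [Set.prod_inter_prod, Set.inter_self]⟩
    · exact absurd (hempty _ _ _) hne.ne_empty
    · exact absurd (Set.inter_comm _ _ ▸ hempty _ _ _) hne.ne_empty
    · refine Or.inr ⟨max i i', A ∩ A', ?_, by rw [Set.prod_inter_prod, Set.Ioi_inter_Ioi]⟩
      exact (ℱ.mono (le_max_left i i') A hA).inter (ℱ.mono (le_max_right i i') A' hA')
  induction B, hB using MeasurableSpace.induction_on_inter (h_eq := rfl) (h_inter := hpi) with
  | empty => simp
  | basic B hB =>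
    rcases hB with ⟨A, hA, rfl⟩ | ⟨i, A, hA, rfl⟩
    -- Time `0` lies outside `(0, T]`, so both sides vanish.
    · have hA' := ℱ.le _ A hA
      rw [Set.preimage_swap_prod, hprod _ _ hA' (measurableSet_singleton _), Measure.prod_prod,
        Measure.restrict_apply (measurableSet_singleton _), Set.singleton_inter_eq_empty.2 (by simp)]
      simp
    · have hA' := ℱ.le _ A hA
      have hC : MeasurableSet (Set.Ioi i ∩ Set.Ioc 0 T) := measurableSet_Ioi.inter measurableSet_Ioc
      have hCm := hξ.measurable_apply hC fun s hs => hs.2.2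
      have hClt : lebesgue (Set.Ioi i ∩ Set.Ioc 0 T) < ∞ :=
        (measure_mono Set.inter_subset_right).trans_lt (lebesgue_Ioc_lt_top _ _)
      rw [Set.preimage_swap_prod, hprod _ _ hA' measurableSet_Ioi, Measure.prod_prod,
        Measure.restrict_apply measurableSet_Ioi, ← hξ.lintegral_apply hC (fun s hs => hs.2.2) hClt]
      -- Here `A` belongs to the past of `i` and the count lives after `i`, so the mean factors as
      -- `P A` times the mean count.
      have hind := lintegral_mul_eq_lintegral_mul_lintegral_of_independent_measurableSpace
        (f := A.indicator fun _ => (1 : ℝ≥0∞)) (g := fun ω => ξ ω (Set.Ioi i ∩ Set.Ioc 0 T))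
        (ℱ.le i) hCm.comap_le (hξ.indep_past i _ hC Set.inter_subset_left)
        (Measurable.indicator (m := ℱ i) measurable_const hA) (comap_measurable _)
      rw [lintegral_indicator_const hA', one_mul] at hind
      rw [← hind, ← lintegral_indicator hA']
      refine lintegral_congr fun ω => ?_
      by_cases hω : ω ∈ A <;> simp [hω]
  | compl B hB ih =>
    rw [Set.preimage_compl, measure_compl (hle B hB) (measure_ne_top _ _),
      measure_compl (hle B hB) (measure_ne_top _ _), ih, huniv]
  | iUnion g hd hg ih =>
    rw [Set.preimage_iUnion, measure_iUnion (fun i j hij => (hd hij).preimage _)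
      (fun i => hle _ (hg i)), measure_iUnion (fun i j hij => (hd hij).preimage _)
      (fun i => hle _ (hg i))]
    exact tsum_congr ih

/-- A predictable set that contains no atom of the Poisson random measure is Lebesgue-null. -/
lemma ae_lebesgue_of_ae_atoms (hξ : IsStandardPoisson P ℱ ξ) {B : Set (ℝ≥0 × Ω)}
    (hB : MeasurableSet[ℱ.predictable] B)
    (hatoms : ∀ᵐ ω ∂P, ∀ s, 0 < s → ξ ω {s} = 1 → (s, ω) ∉ B) :
    ∀ᵐ ω ∂P, ∀ᵐ s ∂lebesgue, 0 < s → (s, ω) ∉ B := by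
  have hT : ∀ n : ℕ, ∀ᵐ ω ∂P, ∀ᵐ s ∂lebesgue.restrict (Set.Ioc 0 (n : ℝ≥0)), (s, ω) ∉ B := by
    intro n
    obtain ⟨κ, hκs, hκ⟩ := exists_kernel_eq_restrict (ξ := ξ) (t := n)
      fun C hC hCt => hξ.measurable_apply hC hCt
    have hκ' : ∀ᵐ ω ∂P, κ ω = (ξ ω).restrict (Set.Ioc 0 (n : ℝ≥0)) := by
      filter_upwards [hξ.ae_eq_natCast measurableSet_Ioc (fun s hs => hs.2)
        (lebesgue_Ioc_lt_top 0 n)] with ω ⟨k, hk⟩ using hκ ω k hk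
    have hBm : MeasurableSet (Prod.swap ⁻¹' B : Set (Ω × ℝ≥0)) :=
      measurable_swap (predictable_le_prod B hB)
    -- The Poisson side charges only atoms, which avoid `B`; the compensation formula carries the
    -- nullity over to `P ⊗ ds`.
    have h0 : (P ⊗ₘ κ) (Prod.swap ⁻¹' B) = 0 := by
      rw [Measure.compProd_apply hBm]
      refine (lintegral_congr_ae ?_).trans lintegral_zero
      filter_upwards [hκ', hatoms, hξ.ae_isSimpleCounting] with ω h1 h2 h3
      have h4 := h3.ae_restrict_of_atoms h2 n
      rw [← h1, ae_iff] at h4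
      simp only [not_not] at h4
      exact h4
    rw [hξ.compProd_apply_predictable hκ' hB, Measure.measure_prod_null hBm] at h0
    filter_upwards [h0] with ω hω
    rw [ae_iff]
    simp only [not_not]
    exact hω
  filter_upwards [ae_all_iff.2 hT] with ω hω
  have h1 : ∀ᵐ s ∂lebesgue, ∀ n : ℕ, s ∈ Set.Ioc 0 (n : ℝ≥0) → (s, ω) ∉ B :=
    ae_all_iff.2 fun n => (ae_restrict_iff' measurableSet_Ioc).1 (hω n)
  filter_upwards [h1] with s hs hs0
  obtain ⟨n, hn⟩ := exists_nat_ge s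
  exact hs n ⟨hs0, hn⟩

end IsStandardPoisson

end

theorem lemma2 {Ω : Type*} [mΩ : MeasurableSpace Ω] (P : Measure Ω) [IsProbabilityMeasure P]
    (ℱ : Filtration ℝ≥0 mΩ) (ξ : Ω → Measure ℝ≥0) (hξ : IsStandardPoisson P ℱ ξ)
    (f : ℝ≥0 → Ω → ℝ) (hf : IsIntegrand P ℱ f)
    (hg : ∀ᵐ ω ∂P, ∀ t : ℝ≥0,
      IntegrableOn (fun s => -f s ω / (1 + f s ω)) (Set.Ioc 0 t) lebesgue)
    (hjump : ∀ᵐ ω ∂P, ∀ t : ℝ≥0, -1 < jump (fun s => compInt ξ f s ω) t) :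
    (∃ Z, IsDoleansDade P ℱ ξ f Z) ∧
    (∃ W, IsDoleansDade P ℱ ξ (fun s ω => -f s ω / (1 + f s ω)) W) ∧
    (∀ᵐ ω ∂P, ∀ t : ℝ≥0,
      IntegrableOn (fun s => f s ω ^ 2 / (1 + f s ω)) (Set.Ioc 0 t) lebesgue) ∧
    ∀ Z W : ℝ≥0 → Ω → ℝ, IsDoleansDade P ℱ ξ f Z →
      IsDoleansDade P ℱ ξ (fun s ω => -f s ω / (1 + f s ω)) W →
      ∀ᵐ ω ∂P, ∀ t : ℝ≥0, Z t ω ≠ 0 ∧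
        (Z t ω)⁻¹ = Real.exp (∫ s in Set.Ioc 0 t, f s ω ^ 2 / (1 + f s ω) ∂lebesgue) * W t ω := by
  have hg' : IsIntegrand P ℱ fun s ω => -f s ω / (1 + f s ω) :=
    ⟨isStronglyPredictable_neg_div hf.predictable, hg⟩
  have hpos : ∀ᵐ ω ∂P, ∀ s, 0 < s → ξ ω {s} = 1 → 0 < 1 + f s ω := by
    filter_upwards [hξ.ae_isSimpleCounting, hf.integrable, hjump] with ω h1 h2 h3 s hs hs1
    have h4 := h3 s
    have h5 : jump (fun s => compInt ξ f s ω) s = f s ω := h1.jump_pathInt h2 hs hs1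
    rw [h5] at h4
    linarith
  have hpos' : ∀ᵐ ω ∂P, ∀ s, 0 < s → ξ ω {s} = 1 → 0 < 1 + -f s ω / (1 + f s ω) := by
    filter_upwards [hpos] with ω h s hs hs1
    have h1 := h s hs hs1
    have h2 : 1 + -f s ω / (1 + f s ω) = (1 + f s ω)⁻¹ := by
      field_simp
      ring
    rw [h2]
    exact inv_pos.2 h1
  -- Positivity at the random atoms excludes `f = -1` at almost every deterministic time, because
  -- `{f = -1}` is predictable.
  have hne : ∀ᵐ ω ∂P, ∀ᵐ s ∂lebesgue, 0 < s → 1 + f s ω ≠ 0 := by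
    have hm : Measurable[ℱ.predictable] (Function.uncurry f) :=
      StronglyMeasurable.measurable hf.predictable
    have hB : MeasurableSet[ℱ.predictable] {p : ℝ≥0 × Ω | 1 + f p.1 p.2 = 0} :=
      (hm.const_add 1) (measurableSet_singleton 0)
    refine hξ.ae_lebesgue_of_ae_atoms hB ?_
    filter_upwards [hpos] with ω h s hs hs1 using (h s hs hs1).ne'
  refine ⟨hξ.exists_isDoleansDade hf hpos, hξ.exists_isDoleansDade hg' hpos', ?_, ?_⟩
  · filter_upwards [hξ.ae_isSimpleCounting, hf.integrable, hg, hpos, hne] with ω h1 h2 h3 h4 h5 t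
    exact (pathExp_inv h2 h3 h1 h4 h5 t).1
  · intro Z W hZ hW
    filter_upwards [hξ.ae_isSimpleCounting, hf.integrable, hg, hpos, hne,
      hξ.eq_pathExp_of_isDoleansDade hf hpos hZ, hξ.eq_pathExp_of_isDoleansDade hg' hpos' hW]
      with ω h1 h2 h3 h4 h5 h6 h7 t
    rw [h6 t, h7 t]
    exact ⟨(pathExp_pos _ _ _).ne', (pathExp_inv h2 h3 h1 h4 h5 t).2⟩
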